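/- Let $S\in\{\frac12,1,\frac32,\dots\}$, let $\gamma\in\mathbb R$ with $2S|\gamma|<\pi$, put $q=e^{i\gamma}$ and $[t]=\frac{\sin\gamma t}{\sin\gamma}$ (with $[t]=t$ if $\gamma=0$). Let $V^S\simeq\mathbb C^{2S+1}$ be the $U_q(sl_2)$-module with orthonormal basis $\omega_k$, $k=-S,\dots,S$, on which $$E\omega_k=\sqrt{[S-k][S+k+1]}\,\omega_{k+1},\quad F\omega_k=\sqrt{[S+k][S-k+1]}\,\omega_{k-1},\quad K\omega_k=q^k\omega_k,\quad H\omega_k=k\,\omega_k ,$$ and let $U_q(sl_2)$ act on tensor products through $\Delta(E)=E\otimes K^{-1}+K\otimes E$, $\Delta(F)=F\otimes K^{-1}+K\otimes F$, $\Delta(K)=K\otimes K$. Let $\mathbb P$ be the flip of $V^S\otimes V^S$ and let $\mathsf R^\pm$ be the universal R-matrices evaluated on $V^S\otimes V^S$: $$\mathsf R^+=q^{H\otimes H}\sum_{n\ge0}\frac{q^{n(n-1)/2}}{[1]\cdots[n]}\bigl((q-q^{-1})F\otimes E\bigr)^n q^{H\otimes H},\qquad \mathsf R^-=\mathbb P(\mathsf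 R^+)^{-1}\mathbb P$$ (the sum runs over $n\le 2S$, since the later powers vanish; $\mathsf R^+$ is invertible). For an operator $\mathsf A$ on $V^S\otimes V^S$ let $\mathsf A_{nm}$ be the operator on $(V^S)^{\otimes N}$ that acts as $\mathsf A$ on the $n$-th and $m$-th tensor factors, in this order, and trivially on the others. For $\mathsf R=\mathsf R^+$ and for $\mathsf R=\mathsf R^-$ put, respectively, $$\eta_N^\pm=\overleftarrow{\mathsf R}_N\cdots\overleftarrow{\mathsf R}_2,\qquad \overleftarrow{\mathsf R}_n=\mathsf R_{n-1,n}\cdots\mathsf R_{1,n}.$$ a) Suppose in addition that $[m]\ne0$ for all integers $1\le m\le 4S$. Then $V^S\otimes V^S=\bigoplus_{s=0}^{2S}V^s$, where $V^s$ is the irreducible submodule of spin $s$ and dimension $2s+1$. Let $\mathsf P^{S,s}$ be the projector onto $V^s$ along the other summands. Then for all $n=1,\dots,N-1$ and $s=0,\dots,2S$ $$\eta_N^\pm\,\mathsf P^{S,s}_{n,n+1}=\bigl(\mathsf P^{S,s}_{n,n+1}\bigr)^*\eta_N^\pm=\mathsf P^{S,s}_{n+1,n}\,\eta_N^\pm .$$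 Hence $\eta_N^\pm\mathsf H=\mathsf H^*\eta_N^\pm$ for every Hamiltonian $\mathsf H=\sum_{n=1}^{N-1}\sum_{s=0}^{2S}b_{n,s}\mathsf P^{S,s}_{n,n+1}$ with real coefficients $b_{n,s}$. b) $\eta_N^\pm=\overrightarrow{\mathsf R}_1\cdots\overrightarrow{\mathsf R}_{N-1}$, where $\overrightarrow{\mathsf R}_n=\mathsf R_{n,n+1}\cdots\mathsf R_{n,N}$. c) $(\eta_N^+)^*=\eta_N^-$. -/

import Mathlib

open scoped Kronecker Matrix

namespace SpinChain

noncomputable section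

/-- The parameter `q = exp (i γ)`, raised to a real power: `q ^ x = exp (i γ x)`. -/
def qPow (γ x : ℝ) : ℂ := Complex.exp (Complex.I * γ * x)

/-- The q-number `[x] = sin (γ x) / sin γ`, with its limiting value `x` at `γ = 0`. -/
def qNum (γ x : ℝ) : ℝ := if γ = 0 then x else Real.sin (γ * x) / Real.sin γ

/-- The q-factorial `[1] [2] ⋯ [n]`. -/
def qFactorial (γ : ℝ) (n : ℕ) : ℝ := ∏ k ∈ Finset.range n, qNum γ ((k : ℝ) + 1)

/-! ### The spin `S` module

The spin is given by the natural number `d = 2 S`. The canonical orthonormal basis `ω_k`,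
`k = -S, …, S`, of the module is indexed by `Fin (d + 1)`; the index `i` stands for `k = i - S`.
A matrix `A` sends `ω_j` to `∑ i, A i j • ω_i`. -/

/-- The weight `k = i - S` of the `i`-th basis vector. -/
def weight (d : ℕ) (i : Fin (d + 1)) : ℝ := (i : ℝ) - (d : ℝ) / 2

/-- `E ω_k = √([S - k] [S + k + 1]) ω_{k+1}`. The square root is taken in `ℂ`, because the
q-numbers can be negative in the modules that occur inside a tensor product. -/
def spinE (γ : ℝ) (d : ℕ) : Matrix (Fin (d + 1)) (Fin (d + 1)) ℂ := fun i j =>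
  if (i : ℕ) = (j : ℕ) + 1 then
    Complex.sqrt ((qNum γ ((d : ℝ) / 2 - weight d j) * qNum γ ((d : ℝ) / 2 + weight d j + 1) : ℝ))
  else 0

/-- `F ω_k = √([S + k] [S - k + 1]) ω_{k-1}`. -/
def spinF (γ : ℝ) (d : ℕ) : Matrix (Fin (d + 1)) (Fin (d + 1)) ℂ := fun i j =>
  if (i : ℕ) + 1 = (j : ℕ) then
    Complex.sqrt ((qNum γ ((d : ℝ) / 2 + weight d j) * qNum γ ((d : ℝ) / 2 - weight d j + 1) : ℝ))
  else 0

/-- `K ω_k = q ^ k ω_k`. -/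
def spinK (γ : ℝ) (d : ℕ) : Matrix (Fin (d + 1)) (Fin (d + 1)) ℂ :=
  Matrix.diagonal fun i => qPow γ (weight d i)

/-- `K⁻¹ ω_k = q ^ (-k) ω_k`. -/
def spinKInv (γ : ℝ) (d : ℕ) : Matrix (Fin (d + 1)) (Fin (d + 1)) ℂ :=
  Matrix.diagonal fun i => qPow γ (-weight d i)

/-! ### Two sites -/

/-- Operators on the tensor square of the spin `d / 2` module, as matrices in the orthonormal
basis `ω_k ⊗ ω_m`. -/
abbrev TwoSite (d : ℕ) : Type :=
  Matrix (Fin (d + 1) × Fin (d + 1)) (Fin (d + 1) × Fin (d + 1)) ℂ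

/-- `Δ(E) = E ⊗ K⁻¹ + K ⊗ E` on the tensor square. -/
def coE (γ : ℝ) (d : ℕ) : TwoSite d := spinE γ d ⊗ₖ spinKInv γ d + spinK γ d ⊗ₖ spinE γ d

/-- `Δ(F) = F ⊗ K⁻¹ + K ⊗ F` on the tensor square. -/
def coF (γ : ℝ) (d : ℕ) : TwoSite d := spinF γ d ⊗ₖ spinKInv γ d + spinK γ d ⊗ₖ spinF γ d

/-- `Δ(K) = K ⊗ K` on the tensor square. -/
def coK (γ : ℝ) (d : ℕ) : TwoSite d := spinK γ d ⊗ₖ spinK γ d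

/-- `T` is (the matrix of) a homomorphism of `U_q(sl₂)`-modules from the spin `s` module to the
tensor square of the spin `d / 2` module. -/
def IsIntertwiner (γ : ℝ) (d s : ℕ)
    (T : Matrix (Fin (d + 1) × Fin (d + 1)) (Fin (2 * s + 1)) ℂ) : Prop :=
  coE γ d * T = T * spinE γ (2 * s) ∧
  coF γ d * T = T * spinF γ (2 * s) ∧
  coK γ d * T = T * spinK γ (2 * s)

/-- The submodule `V^s` of the tensor square of the spin `d / 2` module: the span of all the
images of module homomorphisms from the spin `s` module. -/
def subV (γ : ℝ) (d s : ℕ) : Submodule ℂ (Fin (d + 1) × Fin (d + 1) → ℂ) :=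
  ⨆ (T : Matrix (Fin (d + 1) × Fin (d + 1)) (Fin (2 * s + 1)) ℂ) (_ : IsIntertwiner γ d s T),
    LinearMap.range T.mulVecLin

open Classical in
/-- The projector `P^{S,s}` (`S = d / 2`) onto `V^s` along the sum of the other `V^l`,
`l = 0, …, 2 S`. -/
def proj (γ : ℝ) (d : ℕ) (s : Fin (d + 1)) : TwoSite d :=
  if h : IsCompl (subV γ d s) (⨆ l : {l : Fin (d + 1) // l ≠ s}, subV γ d (l : Fin (d + 1))) then
    LinearMap.toMatrix' ((subV γ d s).projection _ h)
  else 0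

/-- The flip of the two tensor factors. -/
def flip (d : ℕ) : TwoSite d := fun x y => if x = y.swap then 1 else 0

/-- `q ^ (H ⊗ H)`, where `H ω_k = k ω_k`, so that `K = q ^ H`. -/
def qHH (γ : ℝ) (d : ℕ) : TwoSite d :=
  Matrix.diagonal fun x => qPow γ (weight d x.1 * weight d x.2)

/-- The universal R-matrix
`R⁺ = q^(H ⊗ H) (∑ n, q^(n (n - 1) / 2) / [n]! ((q - q⁻¹) F ⊗ E)^n) q^(H ⊗ H)`
on the tensor square of the spin `d / 2` module; there `E ^ (d + 1) = 0`, so that the terms with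
`n > d` vanish. -/
def RPlus (γ : ℝ) (d : ℕ) : TwoSite d :=
  qHH γ d *
    (∑ n ∈ Finset.range (d + 1),
      (qPow γ ((n : ℝ) * ((n : ℝ) - 1) / 2) / (qFactorial γ n : ℂ)) •
        ((qPow γ 1 - qPow γ (-1)) • (spinF γ d ⊗ₖ spinE γ d)) ^ n) *
    qHH γ d

/-- The second R-matrix: the inverse of `R⁺` conjugated by the flip. -/
def RMinus (γ : ℝ) (d : ℕ) : TwoSite d := flip d * (RPlus γ d)⁻¹ * flip d

/-! ### The chain of `N` sites -/

/-- Operators on the `N`-th tensor power of the spin `d / 2` module, as matrices in the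
orthonormal basis of the products `ω_{x 0} ⊗ ⋯ ⊗ ω_{x (N - 1)}`. The adjoint is the conjugate
transpose. -/
abbrev Chain (N d : ℕ) : Type := Matrix (Fin N → Fin (d + 1)) (Fin N → Fin (d + 1)) ℂ

/-- The operator `A_{n m}`: the first factor of `A` acts at the site `n`, the second factor at
the site `m` (`n ≠ m`), and the other sites are left alone. -/
def embed {N d : ℕ} (A : TwoSite d) (n m : Fin N) : Chain N d := fun x y =>
  if ∀ j, j ≠ n → j ≠ m → x j = y j then A (x n, x m) (y n, y m) else 0

/-- `R_{n-1,n} ⋯ R_{1,n}`, the first index decreasing from left to right. -/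
def leftArrow {N d : ℕ} (R : TwoSite d) (n : Fin N) : Chain N d :=
  (((List.finRange N).filter (fun j => j < n)).reverse.map fun j => embed R j n).prod

/-- `R_{n,n+1} ⋯ R_{n,N}`, the second index increasing from left to right. -/
def rightArrow {N d : ℕ} (R : TwoSite d) (n : Fin N) : Chain N d :=
  (((List.finRange N).filter (fun j => n < j)).map fun j => embed R n j).prod

/-- `η_N`, the product of the `leftArrow R n` with `n` decreasing from the last site. The factor
of the first site is an empty product. -/
def eta (N : ℕ) {d : ℕ} (R : TwoSite d) : Chain N d :=
  ((List.finRange N).reverse.map fun n => leftArrow R n).prod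

/-- The product of the `rightArrow R n` with `n` increasing from the first site. The factor of
the last site is an empty product. -/
def etaOp (N : ℕ) {d : ℕ} (R : TwoSite d) : Chain N d :=
  ((List.finRange N).map fun n => rightArrow R n).prod

/-- The left site of the `n`-th bond of the chain. -/
def bondL {N : ℕ} (n : Fin (N - 1)) : Fin N := ⟨n, by omega⟩

/-- The right site of the `n`-th bond of the chain. -/
def bondR {N : ℕ} (n : Fin (N - 1)) : Fin N := ⟨n + 1, by omega⟩

/-- The Hamiltonian `∑ n, ∑ s, b_{n,s} P^{S,s}_{n,n+1}`. -/
def hamiltonian (γ : ℝ) (N d : ℕ) (b : Fin (N - 1) → Fin (d + 1) → ℝ) : Chain N d :=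
  ∑ n, ∑ s, (b n s : ℂ) • embed (proj γ d s) (bondL n) (bondR n)

end

end SpinChain

namespace SpinChain

noncomputable section

/-! ### q-numbers -/

/-! All projectors are handled at once through the two-site Casimir operator `C = Δ(F)Δ(E) + [H +
1/2]²`. It acts on `V^s` as the real number `[s + 1/2]²`, and these numbers are distinct when no
`[m]` vanishes for `1 ≤ m ≤ 4S`; each projector is then a Lagrange polynomial in `C` with real
coefficients (`proj_eq_aeval`). So a) reduces to two facts: `C_{ab}ᴴ = C_{ba}`, because `|q| = 1`
makes the adjoint turn `Δ` into the opposite coproduct, and `η C_{n,n+1} = C_{n+1,n} η`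
(`IsRMatrix.semiconj_eta`).

The second fact rests on two properties of `R`. It intertwines `Δ` with the opposite coproduct
(`RPlus_semiconj_coF`), so `R_{ab}` carries `C_{ab}` to `C_{ba}`. It also fuses: `R_{ac} R_{bc}`
depends on the sites `a, b` only through `Δ(F)` and the total weight (`RPlus_fusion`), so it
commutes with `C_{ab}`. Inside `η` every factor is either disjoint from the bond, or part of such a
pair, or is `R_{n,n+1}` itself. Both properties come from identities for the truncated
q-exponential: its commutation with `F`, its inverse, and its product law for q-commuting arguments.

Fusion and intertwining together give the Yang–Baxter equation, from which b) follows by induction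
on the last site (`listEta_eq_listEtaOp`). Unitarity of the one-site module gives `R⁻ = (R⁺)ᴴ`
(`RMinus_eq`); the adjoint reverses the order of a product, so c) is b) read for `R⁻`.

The decomposition of the tensor square is a dimension count: lowest weight vectors generate a copy
of each spin `s ≤ 2S`, the Casimir eigenvalues make the `V^s` independent, and `∑ (2s + 1) = (2S +
1)²`. -/

theorem qPow_add (γ x y : ℝ) : qPow γ (x + y) = qPow γ x * qPow γ y := by
  simp only [qPow, ← Complex.exp_add]
  congr 1
  push_cast
  ring

@[simp] theorem qPow_zero (γ : ℝ) : qPow γ 0 = 1 := by simp [qPow]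

theorem qPow_ne_zero (γ x : ℝ) : qPow γ x ≠ 0 := Complex.exp_ne_zero _

theorem qPow_mul_qPow_neg (γ x : ℝ) : qPow γ x * qPow γ (-x) = 1 := by
  rw [← qPow_add, add_neg_cancel, qPow_zero]

theorem qPow_pow (γ x : ℝ) (n : ℕ) : qPow γ x ^ n = qPow γ (x * n) := by
  simp only [qPow, ← Complex.exp_nat_mul]
  congr 1
  push_cast
  ring

theorem star_qPow (γ x : ℝ) : star (qPow γ x) = qPow γ (-x) := by
  simp only [qPow, Complex.star_def, ← Complex.exp_conj]
  simp

theorem qPow_eq_cos_add_sin (γ x : ℝ) :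
    qPow γ x = Real.cos (γ * x) + Real.sin (γ * x) * Complex.I := by
  rw [qPow, show Complex.I * γ * x = ((γ * x : ℝ) : ℂ) * Complex.I by push_cast; ring,
    Complex.exp_mul_I]
  push_cast
  rfl

theorem qPow_neg_eq_cos_sub_sin (γ x : ℝ) :
    qPow γ (-x) = Real.cos (γ * x) - Real.sin (γ * x) * Complex.I := by
  rw [qPow_eq_cos_add_sin, mul_neg, Real.cos_neg, Real.sin_neg]
  push_cast
  ring

@[simp] theorem qNum_zero (γ : ℝ) : qNum γ 0 = 0 := by simp [qNum]

theorem qNum_neg (γ x : ℝ) : qNum γ (-x) = -qNum γ x := by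
  unfold qNum
  split_ifs <;> simp [neg_div]

/-- The imaginary parts cancel in `sin (x + y) = e^{-iy} sin x + e^{ix} sin y`. This asymmetric form
drives the recursions for the q-exponential coefficients. -/
theorem qNum_add (γ x y : ℝ) :
    (qNum γ (x + y) : ℂ) = qPow γ (-y) * qNum γ x + qPow γ x * qNum γ y := by
  by_cases h : γ = 0
  · subst h
    simp [qNum, qPow]
  · simp only [qNum, h, if_false, qPow_eq_cos_add_sin γ x, qPow_neg_eq_cos_sub_sin, mul_add,
      Real.sin_add]
    push_cast
    ring

/-- The condition on `γ` under which the q-numbers are not degenerate. -/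
def Regular (γ : ℝ) : Prop := γ = 0 ∨ Real.sin γ ≠ 0

theorem qPow_sub_mul_qNum {γ : ℝ} (h : Regular γ) (x : ℝ) :
    (qPow γ 1 - qPow γ (-1)) * qNum γ x = qPow γ x - qPow γ (-x) := by
  by_cases h0 : γ = 0
  · subst h0
    simp [qPow]
  · have hs : (Real.sin γ : ℂ) ≠ 0 := by exact_mod_cast h.resolve_left h0
    rw [qPow_neg_eq_cos_sub_sin γ 1, qPow_neg_eq_cos_sub_sin γ x, qPow_eq_cos_add_sin γ 1,
      qPow_eq_cos_add_sin γ x, mul_one, qNum, if_neg h0, Complex.ofReal_div]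
    field_simp
    ring

theorem qNum_one {γ : ℝ} (h : Regular γ) : qNum γ 1 = 1 := by
  by_cases h0 : γ = 0
  · simp [qNum, h0]
  · have hs : Real.sin γ ≠ 0 := h.resolve_left h0
    simp [qNum, h0, hs]

/-- Rests on `sin² x - sin² y = sin (x + y) sin (x - y)`; the Casimir computations use this
identity. -/
theorem qNum_sq_sub_sq (γ x y : ℝ) :
    qNum γ x ^ 2 - qNum γ y ^ 2 = qNum γ (x + y) * qNum γ (x - y) := by
  by_cases h : γ = 0
  · simp only [qNum, h, if_true]
    ring
  · simp only [qNum, h, if_false, mul_add, mul_sub, Real.sin_add, Real.sin_sub]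
    have h1 := Real.sin_sq_add_cos_sq (γ * x)
    have h2 := Real.sin_sq_add_cos_sq (γ * y)
    rw [div_pow, div_pow, ← sub_div, div_mul_div_comm, ← sq (Real.sin γ)]
    congr 1
    linear_combination -(Real.sin (γ * x)) ^ 2 * h2 + (Real.sin (γ * y)) ^ 2 * h1

theorem regular_of_abs_lt {γ : ℝ} (h : |γ| < Real.pi) : Regular γ := by
  by_cases h0 : γ = 0
  · exact Or.inl h0
  · exact Or.inr fun hs => h0
      (Real.sin_eq_zero_iff_of_lt_of_lt (abs_lt.1 h).1 (abs_lt.1 h).2 |>.1 hs)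

theorem qNum_pos {γ x : ℝ} (h1 : |γ| < Real.pi) (hx : 0 < x) (h : x * |γ| < Real.pi) :
    0 < qNum γ x := by
  by_cases h0 : γ = 0
  · simpa [qNum, h0] using hx
  · simp only [qNum, h0, if_false]
    rcases lt_or_gt_of_ne h0 with hn | hp
    · rw [abs_of_neg hn] at h h1
      have := Real.sin_pos_of_pos_of_lt_pi (x := -(γ * x)) (by nlinarith) (by nlinarith)
      have h' := Real.sin_pos_of_pos_of_lt_pi (x := -γ) (by linarith) h1
      rw [Real.sin_neg] at this h'
      exact div_pos_of_neg_of_neg (by linarith) (by linarith)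
    · rw [abs_of_pos hp] at h h1
      exact div_pos (Real.sin_pos_of_pos_of_lt_pi (by positivity) (by linarith))
        (Real.sin_pos_of_pos_of_lt_pi hp h1)

/-- `γ` is small enough for the spin `d / 2` module to be unitary. -/
structure Small (γ : ℝ) (d : ℕ) : Prop where
  one_le : 1 ≤ d
  lt_pi : (d : ℝ) * |γ| < Real.pi

namespace Small

variable {γ : ℝ} {d : ℕ}

theorem abs_lt_pi (h : Small γ d) : |γ| < Real.pi := by
  have h1 : (1 : ℝ) ≤ d := by exact_mod_cast h.one_le
  have := abs_nonneg γ
  have := h.lt_pi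
  nlinarith

theorem regular (h : Small γ d) : Regular γ := regular_of_abs_lt h.abs_lt_pi

theorem qNum_pos (h : Small γ d) {x : ℝ} (hx : 0 < x) (hxd : x ≤ d) : 0 < qNum γ x :=
  SpinChain.qNum_pos h.abs_lt_pi hx
    ((mul_le_mul_of_nonneg_right hxd (abs_nonneg γ)).trans_lt h.lt_pi)

theorem qNum_nonneg (h : Small γ d) {x : ℝ} (hx : 0 ≤ x) (hxd : x ≤ d) : 0 ≤ qNum γ x := by
  rcases hx.eq_or_lt with rfl | hx
  · simp
  · exact (h.qNum_pos hx hxd).le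

end Small

theorem qFactorial_succ (γ : ℝ) (n : ℕ) :
    qFactorial γ (n + 1) = qFactorial γ n * qNum γ ((n : ℝ) + 1) := by
  rw [qFactorial, Finset.prod_range_succ, ← qFactorial]

theorem qFactorial_ne_zero {γ : ℝ} {d : ℕ} (h : Small γ d) {n : ℕ} (hn : n ≤ d) :
    qFactorial γ n ≠ 0 := by
  refine Finset.prod_ne_zero_iff.2 fun k hk => (h.qNum_pos (by positivity) ?_).ne'
  have := Finset.mem_range.1 hk
  exact_mod_cast (by omega : k + 1 ≤ d)

/-- The coefficient `q ^ (n (n - 1) / 2) / [n]!` of the q-exponential series. -/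
def expCoeff (γ : ℝ) (n : ℕ) : ℂ := qPow γ ((n : ℝ) * ((n : ℝ) - 1) / 2) / (qFactorial γ n : ℂ)

@[simp] theorem expCoeff_zero (γ : ℝ) : expCoeff γ 0 = 1 := by simp [expCoeff, qFactorial]

/-- Together with the value `1` at `0`, this recursion is what the q-exponential identities below
need from the coefficients. -/
theorem expCoeff_succ_mul {γ : ℝ} {d : ℕ} (h : Small γ d) {n : ℕ} (hn : n + 1 ≤ d) :
    expCoeff γ (n + 1) * qNum γ ((n : ℝ) + 1) = qPow γ n * expCoeff γ n := by
  have h1 : (qFactorial γ n : ℂ) ≠ 0 := by exact_mod_cast qFactorial_ne_zero h (by omega)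
  have h2 : (qFactorial γ (n + 1) : ℂ) ≠ 0 := by exact_mod_cast qFactorial_ne_zero h hn
  rw [qFactorial_succ, Complex.ofReal_mul] at h2
  have h3 := right_ne_zero_of_mul h2
  unfold expCoeff
  rw [qFactorial_succ, Complex.ofReal_mul,
    show ((n + 1 : ℕ) : ℝ) * (((n + 1 : ℕ) : ℝ) - 1) / 2 = n + (n : ℝ) * ((n : ℝ) - 1) / 2 by
      push_cast; ring, qPow_add]
  field_simp

theorem star_expCoeff_succ_mul {γ : ℝ} {d : ℕ} (h : Small γ d) {n : ℕ} (hn : n + 1 ≤ d) :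
    star (expCoeff γ (n + 1)) * qNum γ ((n : ℝ) + 1) = qPow γ (-n) * star (expCoeff γ n) := by
  have := congrArg star (expCoeff_succ_mul h hn)
  rw [star_mul', star_mul', star_qPow] at this
  simpa using this

/-! ### Truncated q-exponentials -/

section Exponential

variable {A : Type*} [Ring A] [Algebra ℂ A]

/-- The truncated power series `∑ n ≤ d, c n • y ^ n`. -/
def truncSeries (c : ℕ → ℂ) (d : ℕ) (y : A) : A := ∑ n ∈ Finset.range (d + 1), c n • y ^ n

theorem map_truncSeries {B : Type*} [Ring B] [Algebra ℂ B] (f : A →ₐ[ℂ] B) (c : ℕ → ℂ) (d : ℕ)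
    (y : A) : f (truncSeries c d y) = truncSeries c d (f y) := by
  simp [truncSeries]

theorem semiconjBy_smul {s x y : A} (h : SemiconjBy s x y) (c : ℂ) :
    SemiconjBy s (c • x) (c • y) := by
  simp only [SemiconjBy, mul_smul_comm, smul_mul_assoc, h.eq]

theorem semiconjBy_sum {A : Type*} [Ring A] {ι : Type*} {s : A} {x y : ι → A} (t : Finset ι)
    (h : ∀ i ∈ t, SemiconjBy s (x i) (y i)) : SemiconjBy s (∑ i ∈ t, x i) (∑ i ∈ t, y i) := by
  simp only [SemiconjBy, Finset.mul_sum, Finset.sum_mul]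
  exact Finset.sum_congr rfl fun i hi => (h i hi).eq

theorem semiconjBy_truncSeries {s x y : A} (h : SemiconjBy s x y) (c : ℕ → ℂ) (d : ℕ) :
    SemiconjBy s (truncSeries c d x) (truncSeries c d y) :=
  semiconjBy_sum _ fun n _ => semiconjBy_smul (h.pow_right n) _

/-- The square and the triangle of indices differ by the corner `k + l > d`, where the terms vanish;
nilpotency thus makes the truncated Cauchy product exact. -/
theorem sum_range_sum_range_eq_sum_antidiagonal {M : Type*} [AddCommMonoid M] (d : ℕ)
    (f : ℕ → ℕ → M) (h : ∀ k l, d < k + l → f k l = 0) :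
    ∑ k ∈ Finset.range (d + 1), ∑ l ∈ Finset.range (d + 1), f k l =
      ∑ n ∈ Finset.range (d + 1), ∑ p ∈ Finset.HasAntidiagonal.antidiagonal n, f p.1 p.2 := by
  rw [← Finset.sum_product' (f := f),
    ← Finset.sum_filter_of_ne (p := fun p : ℕ × ℕ => p.1 + p.2 ≤ d)
      (fun p _ hp => not_lt.1 fun hlt => hp (h _ _ hlt)),
    ← Finset.sum_fiberwise_of_maps_to (g := fun p : ℕ × ℕ => p.1 + p.2)
      (t := Finset.range (d + 1)) (by simp)]
  refine Finset.sum_congr rfl fun n hn => Finset.sum_congr ?_ fun _ _ => rfl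
  ext p
  simp only [Finset.mem_range] at hn
  simp only [Finset.mem_filter, Finset.mem_product, Finset.mem_range,
    Finset.HasAntidiagonal.mem_antidiagonal]
  omega

theorem truncSeries_mul_truncSeries (a b : ℕ → ℂ) (d : ℕ) (u v : A)
    (h : ∀ k l, d < k + l → u ^ k * v ^ l = 0) :
    truncSeries a d u * truncSeries b d v =
      ∑ n ∈ Finset.range (d + 1), ∑ p ∈ Finset.HasAntidiagonal.antidiagonal n,
        (a p.1 * b p.2) • (u ^ p.1 * v ^ p.2) := by
  rw [← sum_range_sum_range_eq_sum_antidiagonal d (fun k l => (a k * b l) • (u ^ k * v ^ l))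
    fun k l hkl => by rw [h k l hkl, smul_zero]]
  simp only [truncSeries, Finset.sum_mul_sum, smul_mul_smul_comm]

variable {γ : ℝ} {d : ℕ}

/-- Multiply by `[n + 1] = [k + l]` and split with `qNum_add`. The recursions shift both halves to
the antidiagonal `k + l = n`, where they agree up to the sign of `(-1)^(l + 1)` and cancel. -/
theorem sum_antidiagonal_expCoeff_mul_star (hs : Small γ d) {n : ℕ} (hn : n + 1 ≤ d) :
    ∑ p ∈ Finset.HasAntidiagonal.antidiagonal (n + 1),
      expCoeff γ p.1 * ((-1) ^ p.2 * star (expCoeff γ p.2)) = 0 := by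
  have h0 : (qNum γ ((n : ℝ) + 1) : ℂ) ≠ 0 := by
    exact_mod_cast (hs.qNum_pos (by positivity) (by exact_mod_cast hn)).ne'
  refine (mul_eq_zero.1 (?_ : (qNum γ ((n : ℝ) + 1) : ℂ) * _ = 0)).resolve_left h0
  have key : ∀ p ∈ Finset.HasAntidiagonal.antidiagonal (n + 1), (qNum γ ((n : ℝ) + 1) : ℂ) *
      (expCoeff γ p.1 * ((-1) ^ p.2 * star (expCoeff γ p.2))) =
      qPow γ (-p.2) * (qNum γ p.1 * expCoeff γ p.1) * ((-1) ^ p.2 * star (expCoeff γ p.2)) +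
      qPow γ p.1 * expCoeff γ p.1 * ((-1) ^ p.2 * (qNum γ p.2 * star (expCoeff γ p.2))) := by
    intro p hp
    have : (n : ℝ) + 1 = (p.1 : ℝ) + p.2 := by
      exact_mod_cast (Finset.HasAntidiagonal.mem_antidiagonal.1 hp).symm
    rw [this, qNum_add]
    ring
  rw [Finset.mul_sum, Finset.sum_congr rfl key, Finset.sum_add_distrib,
    Finset.Nat.sum_antidiagonal_succ, Finset.Nat.sum_antidiagonal_succ']
  simp only [Nat.cast_zero, qNum_zero, Complex.ofReal_zero, zero_mul, mul_zero, zero_add]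
  rw [← Finset.sum_add_distrib]
  refine Finset.sum_eq_zero fun p hp => ?_
  have hp := Finset.HasAntidiagonal.mem_antidiagonal.1 hp
  have h1 := expCoeff_succ_mul hs (n := p.1) (by omega)
  have h2 := star_expCoeff_succ_mul hs (n := p.2) (by omega)
  push_cast
  rw [mul_comm _ (expCoeff γ (p.1 + 1)), h1, mul_comm _ (star (expCoeff γ (p.2 + 1))), h2, pow_succ]
  ring

/-- Conjugating the coefficients replaces `q` by `q⁻¹`, so this is `exp_q(y) exp_{q⁻¹}(-y) = 1`. -/
theorem truncExp_mul_truncExp_neg (hs : Small γ d) {y : A} (hy : y ^ (d + 1) = 0) :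
    truncSeries (expCoeff γ) d y * truncSeries (fun n => star (expCoeff γ n)) d (-y) = 1 := by
  have hz : ∀ n, d < n → y ^ n = 0 := fun n hn => pow_eq_zero_of_le hn hy
  have hneg : truncSeries (fun n => star (expCoeff γ n)) d (-y) =
      truncSeries (fun n => (-1) ^ n * star (expCoeff γ n)) d y := by
    refine Finset.sum_congr rfl fun n _ => ?_
    rw [show -y = (-1 : ℂ) • y by simp, smul_pow, smul_smul, mul_comm]
  rw [hneg, truncSeries_mul_truncSeries _ _ _ _ _ fun k l hkl => by rw [← pow_add, hz _ hkl],
    Finset.sum_range_succ', Finset.sum_eq_zero]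
  · simp
  · intro n hn
    have hn := Finset.mem_range.1 hn
    have : ∀ p ∈ Finset.HasAntidiagonal.antidiagonal (n + 1),
        (expCoeff γ p.1 * ((-1) ^ p.2 * star (expCoeff γ p.2))) • (y ^ p.1 * y ^ p.2) =
        (expCoeff γ p.1 * ((-1) ^ p.2 * star (expCoeff γ p.2))) • y ^ (n + 1) := by
      intro p hp
      rw [← pow_add, Finset.HasAntidiagonal.mem_antidiagonal.1 hp]
    rw [Finset.sum_congr rfl this, ← Finset.sum_smul, sum_antidiagonal_expCoeff_mul_star hs hn,
      zero_smul]

theorem mul_pow_of_mul_eq_smul {x y : A} {c : ℂ} (h : x * y = c • (y * x)) (n : ℕ) :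
    x * y ^ n = c ^ n • (y ^ n * x) := by
  induction n with
  | zero => simp
  | succ n ih =>
    rw [pow_succ, ← mul_assoc, ih, smul_mul_assoc, mul_assoc, h, mul_smul_comm, smul_smul,
      pow_succ, mul_assoc]

/-- The q-binomial theorem in divided powers. After multiplication by `[n + 1]`, the two halves of
the q-Pascal rule are the contributions of `u` and of `v` in `(u + v) (u + v)^n`. -/
theorem expCoeff_smul_add_pow (hs : Small γ d) {u v : A}
    (h : v * u = qPow γ (-2) • (u * v)) {n : ℕ} (hn : n ≤ d) :
    expCoeff γ n • (u + v) ^ n =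
      ∑ p ∈ Finset.HasAntidiagonal.antidiagonal n,
        (expCoeff γ p.1 * expCoeff γ p.2) • (u ^ p.1 * v ^ p.2) := by
  induction n with
  | zero => simp
  | succ n ih =>
    have h0 : (qNum γ ((n : ℝ) + 1) : ℂ) ≠ 0 := by
      exact_mod_cast (hs.qNum_pos (by positivity) (by exact_mod_cast hn)).ne'
    refine smul_right_injective A h0 ?_
    have hv : ∀ k : ℕ, v * u ^ k = qPow γ (-2 * k) • (u ^ k * v) := by
      intro k
      rw [mul_pow_of_mul_eq_smul h, qPow_pow]
    have key : ∀ p ∈ Finset.HasAntidiagonal.antidiagonal (n + 1), (qNum γ ((n : ℝ) + 1) : ℂ) •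
        (expCoeff γ p.1 * expCoeff γ p.2) • (u ^ p.1 * v ^ p.2) =
        (qPow γ p.2 * (expCoeff γ p.1 * qNum γ p.1) * expCoeff γ p.2) • (u ^ p.1 * v ^ p.2) +
        (qPow γ (-p.1) * expCoeff γ p.1 * (expCoeff γ p.2 * qNum γ p.2)) •
          (u ^ p.1 * v ^ p.2) := by
      intro p hp
      -- The order of the summands matters in `qNum_add`: it must give `q^l [k] + q^(-k) [l]`, to
      -- match `q^n` and the factor `q^(-2k)` from moving `v` past `u^k`.
      have : (n : ℝ) + 1 = (p.2 : ℝ) + p.1 := by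
        rw [add_comm (p.2 : ℝ)]
        exact_mod_cast (Finset.HasAntidiagonal.mem_antidiagonal.1 hp).symm
      rw [this, qNum_add, smul_smul, ← add_smul]
      congr 1
      ring
    simp only
    rw [Finset.smul_sum, Finset.sum_congr rfl key, Finset.sum_add_distrib,
      Finset.Nat.sum_antidiagonal_succ, Finset.Nat.sum_antidiagonal_succ']
    simp only [Nat.cast_zero, qNum_zero, Complex.ofReal_zero, zero_mul, mul_zero, zero_add,
      zero_smul]
    rw [← Finset.sum_add_distrib, smul_smul, mul_comm, expCoeff_succ_mul hs hn, pow_succ',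
      mul_smul, ← mul_smul_comm, ih (by omega), Finset.mul_sum, Finset.smul_sum]
    refine Finset.sum_congr rfl fun p hp => ?_
    have hp := Finset.HasAntidiagonal.mem_antidiagonal.1 hp
    have h1 := expCoeff_succ_mul hs (n := p.1) (by omega)
    have h2 := expCoeff_succ_mul hs (n := p.2) (by omega)
    push_cast
    rw [h1, h2, mul_smul_comm, add_mul, ← mul_assoc, ← mul_assoc, hv, ← pow_succ', smul_mul_assoc,
      mul_assoc (u ^ p.1), ← pow_succ', smul_add, smul_add, smul_smul, smul_smul, smul_smul]
    have hnp : (n : ℝ) = p.1 + p.2 := by exact_mod_cast hp.symm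
    congr 2
    · rw [hnp, qPow_add]
      ring
    · rw [hnp, show -(p.1 : ℝ) = p.1 + -2 * p.1 by ring, qPow_add, qPow_add]
      ring

/-- The exponential law for q-commuting arguments. In the application `u` and `v` share a factor `E`
at one site, which gives the joint nilpotency `h0`. -/
theorem truncExp_mul_truncExp (hs : Small γ d) {u v : A} (h : v * u = qPow γ (-2) • (u * v))
    (h0 : ∀ k l, d < k + l → u ^ k * v ^ l = 0) :
    truncSeries (expCoeff γ) d u * truncSeries (expCoeff γ) d v =
      truncSeries (expCoeff γ) d (u + v) := by
  rw [truncSeries_mul_truncSeries _ _ _ _ _ h0]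
  exact Finset.sum_congr rfl fun n hn =>
    (expCoeff_smul_add_pow hs h (Nat.lt_succ_iff.1 (Finset.mem_range.1 hn))).symm

/-- `(q - q⁻¹) [E ^ n, F] = [n] E ^ (n - 1) (q ^ (n - 1) K² - q ^ (1 - n) K⁻²)`. -/
theorem smul_commutator_pow (hr : Regular γ) {E F k k' : A} {c : ℂ}
    (hk : k * E = qPow γ 2 • (E * k)) (hk' : k' * E = qPow γ (-2) • (E * k'))
    (hEF : c • (E * F - F * E) = k - k') (n : ℕ) :
    c • (E ^ (n + 1) * F - F * E ^ (n + 1)) =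
      (qNum γ ((n : ℝ) + 1) : ℂ) • (E ^ n * (qPow γ n • k - qPow γ (-n) • k')) := by
  induction n with
  | zero => simp [qNum_one hr, hEF]
  | succ n ih =>
    have e : E ^ (n + 1 + 1) * F - F * E ^ (n + 1 + 1) =
        E * (E ^ (n + 1) * F - F * E ^ (n + 1)) + (E * F - F * E) * E ^ (n + 1) := by
      rw [pow_succ' E (n + 1)]
      noncomm_ring
    rw [e, smul_add, ← mul_smul_comm, ih, ← smul_mul_assoc c, hEF, sub_mul,
      mul_pow_of_mul_eq_smul hk, mul_pow_of_mul_eq_smul hk', qPow_pow, qPow_pow, mul_smul_comm,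
      ← mul_assoc, ← pow_succ', mul_sub, mul_sub]
    simp only [mul_smul_comm, smul_sub, smul_smul]
    have h1 : (qNum γ ((n : ℝ) + 1 + 1) : ℂ) * qPow γ ((n : ℝ) + 1) =
        qNum γ ((n : ℝ) + 1) * qPow γ n + qPow γ (2 * ((n : ℝ) + 1)) := by
      rw [qNum_add, qNum_one hr,
        show 2 * ((n : ℝ) + 1) = ((n : ℝ) + 1) + ((n : ℝ) + 1) by ring,
        qPow_add γ ((n : ℝ) + 1) ((n : ℝ) + 1)]
      have : qPow γ n = qPow γ (-1) * qPow γ ((n : ℝ) + 1) := by rw [← qPow_add]; congr 1; ring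
      rw [this]
      push_cast
      ring
    have h2 : (qNum γ ((n : ℝ) + 1 + 1) : ℂ) * qPow γ (-((n : ℝ) + 1)) =
        qNum γ ((n : ℝ) + 1) * qPow γ (-n) + qPow γ (-2 * ((n : ℝ) + 1)) := by
      rw [add_comm ((n : ℝ) + 1) 1, qNum_add, qNum_one hr,
        show -2 * ((n : ℝ) + 1) = -((n : ℝ) + 1) + -((n : ℝ) + 1) by ring,
        qPow_add γ (-((n : ℝ) + 1)) (-((n : ℝ) + 1))]
      have : qPow γ (-n) = qPow γ 1 * qPow γ (-((n : ℝ) + 1)) := by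
        rw [← qPow_add]; congr 1; ring
      rw [this]
      push_cast
      ring
    push_cast
    rw [h1, h2, add_smul, add_smul]
    abel

/-- The core of the intertwining property of the R-matrix. Here `G` stands for `F ⊗ 1` and
`k`, `k'` for `1 ⊗ K ^ 2`, `1 ⊗ K ^ (-2)`. -/
theorem truncExp_mul_add (hs : Small γ d) {G E F k k' : A} {c : ℂ}
    (hGE : Commute G E) (hGF : Commute G F) (hGk : Commute G k)
    (hk : k * E = qPow γ 2 • (E * k)) (hk' : k' * E = qPow γ (-2) • (E * k'))
    (hEF : c • (E * F - F * E) = k - k') (hG : G ^ (d + 1) = 0) :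
    truncSeries (expCoeff γ) d (c • (G * E)) * (G * k' + F) =
      (F + G * k) * truncSeries (expCoeff γ) d (c • (G * E)) := by
  set Θ := truncSeries (expCoeff γ) d (c • (G * E)) with hΘ
  have hx : ∀ n, (c • (G * E)) ^ n = c ^ n • (G ^ n * E ^ n) := fun n => by
    rw [smul_pow, hGE.mul_pow]
  suffices h : Θ * F - F * Θ = G * k * Θ - Θ * (G * k') by
    rw [mul_add, add_mul]
    have := sub_eq_sub_iff_add_eq_add.1 h
    rw [add_comm, this, add_comm]
  have e1 : Θ * F - F * Θ = ∑ n ∈ Finset.range (d + 1),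
      expCoeff γ n • c ^ n • (G ^ n * (E ^ n * F - F * E ^ n)) := by
    rw [hΘ, truncSeries, Finset.sum_mul, Finset.mul_sum, ← Finset.sum_sub_distrib]
    refine Finset.sum_congr rfl fun n _ => ?_
    rw [hx, smul_mul_assoc, smul_mul_assoc, mul_smul_comm, mul_smul_comm, ← smul_sub, ← smul_sub,
      mul_sub, mul_assoc, ← mul_assoc F, ← (hGF.pow_left n).eq, mul_assoc]
  have e2 : G * k * Θ - Θ * (G * k') = ∑ n ∈ Finset.range (d + 1),
      expCoeff γ n • c ^ n • (G ^ (n + 1) * (E ^ n * (qPow γ (2 * n) • k - k'))) := by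
    rw [hΘ, truncSeries, Finset.sum_mul, Finset.mul_sum, ← Finset.sum_sub_distrib]
    refine Finset.sum_congr rfl fun n _ => ?_
    rw [hx, smul_mul_assoc, smul_mul_assoc, mul_smul_comm, mul_smul_comm, ← smul_sub, ← smul_sub,
      mul_sub, mul_sub]
    congr 3
    · rw [mul_assoc, ← mul_assoc k, ← (hGk.pow_left n).eq, mul_assoc (G ^ n),
        mul_pow_of_mul_eq_smul hk, qPow_pow, ← mul_assoc, ← pow_succ', mul_smul_comm (qPow γ _) (E ^ n)]
    · rw [mul_assoc, ← mul_assoc (E ^ n), ← (hGE.pow_right n).eq, mul_assoc G, ← mul_assoc,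
        ← pow_succ]
  -- The term `n = 0` of the first sum is a commutator with `1` and the term `n = d` of the second
  -- contains `G^(d + 1)`. Both vanish, and term `n + 1` of the first sum is compared with term `n`
  -- of the second.
  rw [e1, e2, Finset.sum_range_succ', Finset.sum_range_succ _ d, hG]
  simp only [pow_zero, one_mul, mul_one, sub_self, smul_zero, add_zero, zero_mul]
  refine Finset.sum_congr rfl fun n hn => ?_
  have hn := Finset.mem_range.1 hn
  rw [pow_succ c, mul_smul, ← mul_smul_comm, smul_commutator_pow hs.regular hk hk' hEF,
    mul_smul_comm, smul_comm (c ^ n), smul_smul, expCoeff_succ_mul hs hn, mul_comm, mul_smul]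
  congr 1
  rw [smul_comm, ← mul_smul_comm, ← mul_smul_comm (qPow γ n) (E ^ n), smul_sub, smul_smul, smul_smul, ← qPow_add,
    ← qPow_add, add_neg_cancel, qPow_zero, one_smul, two_mul]

end Exponential

/-! ### One site -/

section OneSite

variable {γ : ℝ} {d : ℕ}

/-- The matrix element `√([d - n] [n + 1])` between the basis vectors with indices `n`, `n + 1`. -/
def ladder (γ : ℝ) (d n : ℕ) : ℂ :=
  Complex.sqrt ((qNum γ ((d : ℝ) - n) * qNum γ ((n : ℝ) + 1) : ℝ))

theorem sqrt_mul_self (z : ℂ) : Complex.sqrt z * Complex.sqrt z = z := by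
  rw [Complex.sqrt, ← sq]
  exact_mod_cast Complex.cpow_nat_inv_pow z two_ne_zero

theorem ladder_mul_self (γ : ℝ) (d n : ℕ) : ladder γ d n * ladder γ d n =
    ((qNum γ ((d : ℝ) - n) * qNum γ ((n : ℝ) + 1) : ℝ) : ℂ) := sqrt_mul_self _

/-- The bound `2S|γ| < π` makes the radicand nonnegative. Hence `F` and `E` are adjoint on one site;
they are transposes of each other without any bound. -/
theorem star_ladder (hs : Small γ d) {n : ℕ} (hn : n ≤ d) : star (ladder γ d n) = ladder γ d n := by
  have h : 0 ≤ qNum γ ((d : ℝ) - n) * qNum γ ((n : ℝ) + 1) := by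
    rcases hn.eq_or_lt with rfl | hn
    · simp
    · have h1 : (n : ℝ) + 1 ≤ d := by exact_mod_cast hn
      have h2 : (0 : ℝ) ≤ n := by positivity
      exact mul_nonneg (hs.qNum_nonneg (by linarith) (by linarith))
        (hs.qNum_nonneg (by linarith) h1)
  rw [ladder, Complex.sqrt_of_nonneg (by exact_mod_cast h)]
  simp

theorem ladder_ne_zero {n : ℕ} (h1 : qNum γ ((d : ℝ) - n) ≠ 0) (h2 : qNum γ ((n : ℝ) + 1) ≠ 0) :
    ladder γ d n ≠ 0 := fun h => by
  have := ladder_mul_self γ d n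
  rw [h, zero_mul] at this
  exact mul_ne_zero h1 h2 (by exact_mod_cast this.symm)

theorem Small.ladder_ne_zero (hs : Small γ d) {n : ℕ} (hn : n < d) : ladder γ d n ≠ 0 := by
  have h1 : (n : ℝ) + 1 ≤ d := by exact_mod_cast hn
  have h2 : (0 : ℝ) ≤ n := by positivity
  exact SpinChain.ladder_ne_zero (hs.qNum_pos (by linarith) (by linarith)).ne'
    (hs.qNum_pos (by linarith) h1).ne'

theorem spinE_apply (i j : Fin (d + 1)) :
    spinE γ d i j = if (i : ℕ) = (j : ℕ) + 1 then ladder γ d j else 0 := by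
  unfold spinE ladder weight
  congr 5 <;> ring_nf

theorem spinF_apply (i j : Fin (d + 1)) :
    spinF γ d i j = if (i : ℕ) + 1 = (j : ℕ) then ladder γ d i else 0 := by
  unfold spinF ladder weight
  split_ifs with h
  · have h : (j : ℝ) = i + 1 := by exact_mod_cast h.symm
    rw [mul_comm, h]
    congr 4 <;> ring
  · rfl

theorem transpose_spinF : (spinF γ d)ᵀ = spinE γ d := by
  ext i j
  rw [Matrix.transpose_apply, spinE_apply, spinF_apply]
  simp only [eq_comm]

theorem transpose_spinE : (spinE γ d)ᵀ = spinF γ d := by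
  rw [← transpose_spinF, Matrix.transpose_transpose]

theorem conjTranspose_spinF (hs : Small γ d) : (spinF γ d)ᴴ = spinE γ d := by
  ext i j
  rw [Matrix.conjTranspose_apply, spinE_apply, spinF_apply]
  split_ifs with h1 h2 h2
  · exact star_ladder hs (by omega)
  · omega
  · omega
  · simp

theorem conjTranspose_spinE (hs : Small γ d) : (spinE γ d)ᴴ = spinF γ d := by
  rw [← conjTranspose_spinF hs, Matrix.conjTranspose_conjTranspose]

theorem spinE_mul_spinF : spinE γ d * spinF γ d = Matrix.diagonal fun i : Fin (d + 1) =>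
    ((qNum γ i * qNum γ ((d : ℝ) - i + 1) : ℝ) : ℂ) := by
  ext i j
  rw [Matrix.mul_apply, Matrix.diagonal_apply]
  simp only [spinE_apply, spinF_apply]
  split_ifs with h
  · subst h
    by_cases hi : (i : ℕ) = 0
    · rw [Finset.sum_eq_zero]
      · simp [hi]
      · intro k _
        rw [if_neg (by omega), zero_mul]
    · have hk : (i : ℕ) - 1 < d + 1 := by omega
      rw [Finset.sum_eq_single (⟨(i : ℕ) - 1, hk⟩ : Fin (d + 1))]
      · have h1 : (((i : ℕ) - 1 : ℕ) : ℝ) = (i : ℝ) - 1 := by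
          rw [Nat.cast_sub (by omega), Nat.cast_one]
        rw [if_pos (by simp; omega), if_pos (by simp; omega), ladder_mul_self]
        simp only [h1]
        rw [mul_comm]
        congr 3 <;> ring
      · intro k _ hk'
        rw [if_neg, zero_mul]
        intro hk''
        apply hk'
        ext
        simp
        omega
      · simp
  · refine Finset.sum_eq_zero fun k _ => ?_
    split_ifs with h1 h2
    · exact absurd (Fin.ext (by omega)) h
    all_goals simp

theorem spinF_mul_spinE : spinF γ d * spinE γ d = Matrix.diagonal fun i : Fin (d + 1) =>
    ((qNum γ ((d : ℝ) - i) * qNum γ ((i : ℝ) + 1) : ℝ) : ℂ) := by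
  ext i j
  rw [Matrix.mul_apply, Matrix.diagonal_apply]
  simp only [spinE_apply, spinF_apply]
  split_ifs with h
  · subst h
    by_cases hi : (i : ℕ) = d
    · rw [Finset.sum_eq_zero]
      · simp [hi]
      · intro k _
        rw [if_neg (by omega), zero_mul]
    · have hk : (i : ℕ) + 1 < d + 1 := by omega
      rw [Finset.sum_eq_single (⟨(i : ℕ) + 1, hk⟩ : Fin (d + 1))]
      · rw [if_pos rfl, ladder_mul_self]
      · intro k _ hk'
        rw [if_neg, zero_mul]
        intro hk''
        apply hk'
        ext
        exact hk''.symm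
      · simp
  · refine Finset.sum_eq_zero fun k _ => ?_
    split_ifs with h1 h2
    · exact absurd (Fin.ext (by omega)) h
    all_goals simp

/-- The products are `[s + 1/2]² - [k - 1/2]²` and `[s + 1/2]² - [k + 1/2]²`, and the remaining
difference of squares is `[2k][1]`. -/
theorem qNum_mul_qNum_sub (hr : Regular γ) (s k : ℝ) :
    qNum γ (s + k) * qNum γ (s - k + 1) - qNum γ (s - k) * qNum γ (s + k + 1) =
      qNum γ (2 * k) := by
  have h1 := qNum_sq_sub_sq γ (s + 1 / 2) (k - 1 / 2)
  have h2 := qNum_sq_sub_sq γ (s + 1 / 2) (k + 1 / 2)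
  have h3 := qNum_sq_sub_sq γ (k + 1 / 2) (k - 1 / 2)
  rw [show s + 1 / 2 + (k - 1 / 2) = s + k by ring,
    show s + 1 / 2 - (k - 1 / 2) = s - k + 1 by ring] at h1
  rw [show s + 1 / 2 + (k + 1 / 2) = s + k + 1 by ring,
    show s + 1 / 2 - (k + 1 / 2) = s - k by ring] at h2
  rw [show k + 1 / 2 + (k - 1 / 2) = 2 * k by ring,
    show k + 1 / 2 - (k - 1 / 2) = 1 by ring, qNum_one hr] at h3
  linear_combination h2 - h1 + h3

theorem spin_commutator (hr : Regular γ) : spinE γ d * spinF γ d - spinF γ d * spinE γ d =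
    Matrix.diagonal fun i : Fin (d + 1) => (qNum γ (2 * weight d i) : ℂ) := by
  rw [spinE_mul_spinF, spinF_mul_spinE, Matrix.diagonal_sub]
  congr 1
  ext i
  have h := qNum_mul_qNum_sub hr ((d : ℝ) / 2) (weight d i)
  rw [← h, ← Complex.ofReal_sub, weight]
  congr 4 <;> ring_nf

theorem spinE_pow_apply_ne_zero {n : ℕ} {i j : Fin (d + 1)} (h : (spinE γ d ^ n) i j ≠ 0) :
    (i : ℕ) = j + n := by
  induction n generalizing j with
  | zero =>
    rw [pow_zero] at h
    by_contra hij
    exact h (Matrix.one_apply_ne fun e => hij (by simp [e]))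
  | succ n ih =>
    rw [pow_succ, Matrix.mul_apply] at h
    obtain ⟨k, _, hk⟩ := Finset.exists_ne_zero_of_sum_ne_zero h
    have h1 := ih (left_ne_zero_of_mul hk)
    have h2 := right_ne_zero_of_mul hk
    rw [spinE_apply] at h2
    have := (ite_ne_right_iff.1 h2).1
    omega

theorem spinE_pow_eq_zero {n : ℕ} (hn : d < n) : spinE γ d ^ n = 0 := by
  ext i j
  by_contra h
  have := spinE_pow_apply_ne_zero h
  omega

theorem spinF_pow_eq_zero {n : ℕ} (hn : d < n) : spinF γ d ^ n = 0 := by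
  rw [← transpose_spinE, ← Matrix.transpose_pow, spinE_pow_eq_zero hn, Matrix.transpose_zero]

theorem weight_of_eq_add_one {i j : Fin (d + 1)} (h : (i : ℕ) = j + 1) :
    weight d i = weight d j + 1 := by
  simp only [weight, h]
  push_cast
  ring

theorem diagonal_mul_spinE {f g : Fin (d + 1) → ℂ} {c : ℂ}
    (h : ∀ i j : Fin (d + 1), (i : ℕ) = j + 1 → f i = c * g j) :
    Matrix.diagonal f * spinE γ d = c • (spinE γ d * Matrix.diagonal g) := by
  ext i j
  rw [Matrix.diagonal_mul, Matrix.smul_apply, Matrix.mul_diagonal, spinE_apply]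
  split_ifs with hij
  · rw [h i j hij, smul_eq_mul]
    ring
  · simp

theorem spinK_mul_spinE : spinK γ d * spinE γ d = qPow γ 1 • (spinE γ d * spinK γ d) :=
  diagonal_mul_spinE fun i j hij => by rw [weight_of_eq_add_one hij, add_comm, qPow_add]

theorem spinKInv_mul_spinE :
    spinKInv γ d * spinE γ d = qPow γ (-1) • (spinE γ d * spinKInv γ d) :=
  diagonal_mul_spinE fun i j hij => by rw [weight_of_eq_add_one hij, neg_add_rev, qPow_add]

theorem transpose_spinK : (spinK γ d)ᵀ = spinK γ d := Matrix.diagonal_transpose _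

theorem transpose_spinKInv : (spinKInv γ d)ᵀ = spinKInv γ d := Matrix.diagonal_transpose _

theorem spinF_mul_spinK : spinF γ d * spinK γ d = qPow γ 1 • (spinK γ d * spinF γ d) := by
  have := congrArg Matrix.transpose (spinK_mul_spinE (γ := γ) (d := d))
  simpa only [Matrix.transpose_mul, Matrix.transpose_smul, transpose_spinE, transpose_spinK]
    using this

theorem spinF_mul_spinKInv :
    spinF γ d * spinKInv γ d = qPow γ (-1) • (spinKInv γ d * spinF γ d) := by
  have := congrArg Matrix.transpose (spinKInv_mul_spinE (γ := γ) (d := d))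
  simpa only [Matrix.transpose_mul, Matrix.transpose_smul, transpose_spinE, transpose_spinKInv]
    using this

theorem conjTranspose_spinK : (spinK γ d)ᴴ = spinKInv γ d := by
  rw [spinK, spinKInv, Matrix.diagonal_conjTranspose]
  congr 1
  ext i
  exact star_qPow _ _

theorem conjTranspose_spinKInv : (spinKInv γ d)ᴴ = spinK γ d := by
  rw [← conjTranspose_spinK, Matrix.conjTranspose_conjTranspose]

end OneSite

/-! ### The R-matrix on two sites -/

section TwoSites

variable {γ : ℝ} {d : ℕ}

/-- Conjugation by the flip. -/
def swapConj (d : ℕ) : TwoSite d →ₐ[ℂ] TwoSite d :=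
  (Matrix.reindexAlgEquiv ℂ ℂ (Equiv.prodComm (Fin (d + 1)) (Fin (d + 1)))).toAlgHom

theorem swapConj_apply (A : TwoSite d) (x y) : swapConj d A x y = A x.swap y.swap := rfl

@[simp] theorem swapConj_swapConj (A : TwoSite d) : swapConj d (swapConj d A) = A := rfl

theorem swapConj_kronecker (A B : Matrix (Fin (d + 1)) (Fin (d + 1)) ℂ) :
    swapConj d (A ⊗ₖ B) = B ⊗ₖ A := by
  ext x y
  exact mul_comm _ _

theorem swapConj_transpose (A : TwoSite d) : (swapConj d A)ᵀ = swapConj d Aᵀ := rfl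

theorem swapConj_conjTranspose (A : TwoSite d) : (swapConj d A)ᴴ = swapConj d Aᴴ := rfl

theorem swapConj_diagonal (f : Fin (d + 1) × Fin (d + 1) → ℂ) :
    swapConj d (Matrix.diagonal f) = Matrix.diagonal fun x => f x.swap := by
  ext x y
  rw [swapConj_apply, Matrix.diagonal_apply, Matrix.diagonal_apply]
  simp only [Prod.swap_inj]

theorem flip_mul_mul_flip (A : TwoSite d) : flip d * A * flip d = swapConj d A := by
  ext x y
  have h1 : ∀ z, (flip d * A) x z = A x.swap z := by
    intro z
    rw [Matrix.mul_apply, Finset.sum_eq_single x.swap]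
    · simp [flip]
    · intro w _ hw
      rw [flip, if_neg, zero_mul]
      rintro rfl
      exact hw (by simp)
    · simp
  rw [Matrix.mul_apply, Finset.sum_eq_single y.swap, h1]
  · simp [flip, swapConj_apply]
  · intro w _ hw
    rw [flip, if_neg hw, mul_zero]
  · simp

theorem transpose_truncSeries {m : Type*} [Fintype m] [DecidableEq m] (c : ℕ → ℂ) (n : ℕ)
    (A : Matrix m m ℂ) : (truncSeries c n A)ᵀ = truncSeries c n Aᵀ := by
  simp [truncSeries, Matrix.transpose_sum]

theorem conjTranspose_truncSeries {m : Type*} [Fintype m] [DecidableEq m] (c : ℕ → ℂ) (n : ℕ)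
    (A : Matrix m m ℂ) : (truncSeries c n A)ᴴ = truncSeries (fun k => star (c k)) n Aᴴ := by
  simp [truncSeries, Matrix.conjTranspose_sum]

theorem transpose_kronecker (A B : Matrix (Fin (d + 1)) (Fin (d + 1)) ℂ) :
    (A ⊗ₖ B)ᵀ = Aᵀ ⊗ₖ Bᵀ := rfl

theorem conjTranspose_kronecker' (A B : Matrix (Fin (d + 1)) (Fin (d + 1)) ℂ) :
    (A ⊗ₖ B)ᴴ = Aᴴ ⊗ₖ Bᴴ := Matrix.conjTranspose_kronecker A B

/-- The scalar `q - q⁻¹`. -/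
def qDiff (γ : ℝ) : ℂ := qPow γ 1 - qPow γ (-1)

theorem star_qDiff (γ : ℝ) : star (qDiff γ) = -qDiff γ := by
  simp only [qDiff, star_sub, star_qPow, neg_neg, neg_sub]

theorem RPlus_eq (γ : ℝ) (d : ℕ) : RPlus γ d =
    qHH γ d * truncSeries (expCoeff γ) d (qDiff γ • (spinF γ d ⊗ₖ spinE γ d)) * qHH γ d := rfl

theorem kronecker_pow (A B : Matrix (Fin (d + 1)) (Fin (d + 1)) ℂ) (n : ℕ) :
    (A ⊗ₖ B) ^ n = (A ^ n) ⊗ₖ (B ^ n) := by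
  induction n with
  | zero => simp
  | succ n ih => rw [pow_succ, ih, ← Matrix.mul_kronecker_mul, pow_succ, pow_succ]

/-- A rule for moving `q ^ (H ⊗ H)` past a product of ladder operators. -/
theorem qHH_mul_kronecker {A A' B B' : Matrix (Fin (d + 1)) (Fin (d + 1)) ℂ}
    (h : ∀ x y : Fin (d + 1) × Fin (d + 1),
      qPow γ (weight d x.1 * weight d x.2) * (A x.1 y.1 * B x.2 y.2) =
        A' x.1 y.1 * B' x.2 y.2 * qPow γ (weight d y.1 * weight d y.2)) :
    SemiconjBy (qHH γ d) (A ⊗ₖ B) (A' ⊗ₖ B') := by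
  ext x y
  rw [qHH, Matrix.diagonal_mul, Matrix.mul_diagonal]
  exact h x y

theorem transpose_qHH : (qHH γ d)ᵀ = qHH γ d := Matrix.diagonal_transpose _

theorem swapConj_qHH : swapConj d (qHH γ d) = qHH γ d := by
  rw [qHH, swapConj_diagonal]
  simp only [Prod.fst_swap, Prod.snd_swap, mul_comm]

theorem qHH_mul_conjTranspose : qHH γ d * (qHH γ d)ᴴ = 1 := by
  rw [qHH, Matrix.diagonal_conjTranspose, Matrix.diagonal_mul_diagonal]
  simp only [Pi.star_apply, star_qPow, qPow_mul_qPow_neg, Matrix.diagonal_one]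

/-- A ladder operator at one site shifts that weight by one, so moving `q^(H ⊗ H)` past it produces
`K` or `K⁻¹` at the other site. The four rules for `F` bring `Δ(F)` and its opposite to the forms in
`truncExp_mul_add`; the two rules for `E` serve fusion. -/
theorem qHH_semiconj_F_KInv : SemiconjBy (qHH γ d) (spinF γ d ⊗ₖ spinKInv γ d)
    (spinF γ d ⊗ₖ (spinKInv γ d * spinKInv γ d)) := by
  refine qHH_mul_kronecker fun x y => ?_
  simp only [spinKInv, Matrix.diagonal_mul_diagonal, Matrix.diagonal_apply, spinF_apply]
  split_ifs with h1 h2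
  · rw [weight_of_eq_add_one h1.symm, h2, mul_left_comm, mul_assoc, ← qPow_add, ← qPow_add,
      ← qPow_add]
    congr 2
    ring
  all_goals simp

theorem qHH_semiconj_K_F : SemiconjBy (qHH γ d) (spinK γ d ⊗ₖ spinF γ d) (1 ⊗ₖ spinF γ d) := by
  refine qHH_mul_kronecker fun x y => ?_
  simp only [spinK, Matrix.diagonal_apply, spinF_apply, Matrix.one_apply]
  split_ifs with h1 h2
  · rw [weight_of_eq_add_one h2.symm, h1, one_mul, ← mul_assoc, ← qPow_add, mul_comm]
    congr 2
    ring
  all_goals simp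

theorem qHH_semiconj_one_F :
    SemiconjBy (qHH γ d) (1 ⊗ₖ spinF γ d) (spinKInv γ d ⊗ₖ spinF γ d) := by
  refine qHH_mul_kronecker fun x y => ?_
  simp only [spinKInv, Matrix.diagonal_apply, spinF_apply, Matrix.one_apply]
  split_ifs with h1 h2
  · rw [weight_of_eq_add_one h2.symm, h1, one_mul, mul_right_comm, ← qPow_add]
    congr 2
    ring
  all_goals simp

theorem qHH_semiconj_F_KK : SemiconjBy (qHH γ d) (spinF γ d ⊗ₖ (spinK γ d * spinK γ d))
    (spinF γ d ⊗ₖ spinK γ d) := by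
  refine qHH_mul_kronecker fun x y => ?_
  simp only [spinK, Matrix.diagonal_mul_diagonal, Matrix.diagonal_apply, spinF_apply]
  split_ifs with h1 h2
  · rw [weight_of_eq_add_one h1.symm, h2, mul_left_comm, mul_assoc, ← qPow_add, ← qPow_add,
      ← qPow_add]
    congr 2
    ring
  all_goals simp

theorem qHH_semiconj_one_E : SemiconjBy (qHH γ d) (1 ⊗ₖ spinE γ d) (spinK γ d ⊗ₖ spinE γ d) := by
  refine qHH_mul_kronecker fun x y => ?_
  simp only [spinK, Matrix.diagonal_apply, spinE_apply, Matrix.one_apply]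
  split_ifs with h1 h2
  · rw [weight_of_eq_add_one h2, h1, one_mul, mul_right_comm, ← qPow_add]
    congr 2
    ring
  all_goals simp

theorem qHH_semiconj_KInv_E :
    SemiconjBy (qHH γ d) (spinKInv γ d ⊗ₖ spinE γ d) (1 ⊗ₖ spinE γ d) := by
  refine qHH_mul_kronecker fun x y => ?_
  simp only [spinKInv, Matrix.diagonal_apply, spinE_apply, Matrix.one_apply]
  split_ifs with h1 h2
  · rw [weight_of_eq_add_one h2, h1, one_mul, ← mul_assoc, ← qPow_add, mul_comm]
    congr 2
    ring
  all_goals simp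

theorem swapConj_coF : swapConj d (coF γ d) =
    spinKInv γ d ⊗ₖ spinF γ d + spinF γ d ⊗ₖ spinK γ d := by
  rw [coF, map_add, swapConj_kronecker, swapConj_kronecker]

theorem transpose_coF : (coF γ d)ᵀ = coE γ d := by
  rw [coF, coE, Matrix.transpose_add, transpose_kronecker, transpose_kronecker, transpose_spinF,
    transpose_spinK, transpose_spinKInv]

theorem transpose_coE : (coE γ d)ᵀ = coF γ d := by
  rw [← transpose_coF, Matrix.transpose_transpose]

/-- As `|q| = 1`, the adjoint of `K` is `K⁻¹`, which reverses the coproduct. This is why the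
projectors are not Hermitian and a metric operator is needed. -/
theorem conjTranspose_coF (hs : Small γ d) : (coF γ d)ᴴ = swapConj d (coE γ d) := by
  rw [coF, coE, Matrix.conjTranspose_add, conjTranspose_kronecker', conjTranspose_kronecker',
    conjTranspose_spinF hs, conjTranspose_spinK, conjTranspose_spinKInv, map_add,
    swapConj_kronecker, swapConj_kronecker]
  exact add_comm _ _

theorem conjTranspose_coE (hs : Small γ d) : (coE γ d)ᴴ = swapConj d (coF γ d) := by
  rw [← swapConj_swapConj (coE γ d), ← conjTranspose_coF hs, swapConj_conjTranspose,
    Matrix.conjTranspose_conjTranspose]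

theorem RPlus_semiconj_coF (hs : Small γ d) :
    SemiconjBy (RPlus γ d) (coF γ d) (swapConj d (coF γ d)) := by
  have hdiag : qDiff γ • (spinE γ d * spinF γ d - spinF γ d * spinE γ d) =
      spinK γ d * spinK γ d - spinKInv γ d * spinKInv γ d := by
    rw [spin_commutator hs.regular, spinK, spinKInv, Matrix.diagonal_mul_diagonal,
      Matrix.diagonal_mul_diagonal, Matrix.diagonal_sub, ← Matrix.diagonal_smul]
    congr 1
    ext i
    rw [Pi.smul_apply, smul_eq_mul, qDiff, qPow_sub_mul_qNum hs.regular, ← qPow_add, ← qPow_add]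
    congr 2 <;> ring
  have hcore := truncExp_mul_add hs (A := TwoSite d) (G := spinF γ d ⊗ₖ 1) (E := 1 ⊗ₖ spinE γ d)
    (F := 1 ⊗ₖ spinF γ d) (k := 1 ⊗ₖ (spinK γ d * spinK γ d))
    (k' := 1 ⊗ₖ (spinKInv γ d * spinKInv γ d)) (c := qDiff γ)
    (by simp [Commute, SemiconjBy, ← Matrix.mul_kronecker_mul])
    (by simp [Commute, SemiconjBy, ← Matrix.mul_kronecker_mul])
    (by simp [Commute, SemiconjBy, ← Matrix.mul_kronecker_mul])
    (by
      rw [← Matrix.mul_kronecker_mul, ← Matrix.mul_kronecker_mul, ← Matrix.kronecker_smul,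
        mul_assoc, spinK_mul_spinE, mul_smul_comm, ← mul_assoc, spinK_mul_spinE, smul_mul_assoc,
        smul_smul, ← qPow_add, mul_assoc]
      norm_num)
    (by
      rw [← Matrix.mul_kronecker_mul, ← Matrix.mul_kronecker_mul, ← Matrix.kronecker_smul,
        mul_assoc, spinKInv_mul_spinE, mul_smul_comm, ← mul_assoc, spinKInv_mul_spinE,
        smul_mul_assoc, smul_smul, ← qPow_add, mul_assoc]
      norm_num)
    (by
      rw [← Matrix.mul_kronecker_mul, ← Matrix.mul_kronecker_mul, one_mul]
      have := congrArg (fun X => (1 : Matrix (Fin (d + 1)) (Fin (d + 1)) ℂ) ⊗ₖ X) hdiag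
      simp only [sub_eq_add_neg, Matrix.kronecker_smul, Matrix.kronecker_add] at this ⊢
      have hneg : ∀ X : Matrix (Fin (d + 1)) (Fin (d + 1)) ℂ,
          (1 : Matrix (Fin (d + 1)) (Fin (d + 1)) ℂ) ⊗ₖ (-X) = -(1 ⊗ₖ X) := by
        intro X
        ext x y
        simp
      rwa [hneg, hneg] at this)
    (by rw [kronecker_pow, spinF_pow_eq_zero (Nat.lt_succ_self d), Matrix.zero_kronecker])
  simp only [← Matrix.mul_kronecker_mul, one_mul, mul_one] at hcore
  rw [RPlus_eq]
  have hleft : SemiconjBy (qHH γ d) (1 ⊗ₖ spinF γ d + spinF γ d ⊗ₖ (spinK γ d * spinK γ d))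
      (swapConj d (coF γ d)) := by
    rw [swapConj_coF]
    exact qHH_semiconj_one_F.add_right qHH_semiconj_F_KK
  -- The three factors of `R⁺` act in turn: `Δ(F)` becomes `F ⊗ K⁻² + 1 ⊗ F`, then `1 ⊗ F + F ⊗ K²`,
  -- then the opposite coproduct.
  exact (hleft.mul_left hcore).mul_left (qHH_semiconj_F_KInv.add_right qHH_semiconj_K_F)

theorem transpose_RPlus : (RPlus γ d)ᵀ = swapConj d (RPlus γ d) := by
  rw [RPlus_eq, Matrix.transpose_mul, Matrix.transpose_mul, transpose_truncSeries,
    Matrix.transpose_smul, transpose_kronecker, transpose_spinF, transpose_spinE, transpose_qHH,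
    map_mul, map_mul, map_truncSeries, map_smul, swapConj_kronecker, swapConj_qHH, mul_assoc]

/-- Transposition exchanges `E` and `F`, fixes `K` and flips `R⁺`, so the relation for `F` yields
this one without a second computation. -/
theorem RPlus_semiconj_coE (hs : Small γ d) :
    SemiconjBy (RPlus γ d) (coE γ d) (swapConj d (coE γ d)) := by
  have h := congrArg Matrix.transpose (RPlus_semiconj_coF hs).eq
  rw [Matrix.transpose_mul, Matrix.transpose_mul, transpose_RPlus, swapConj_transpose,
    transpose_coF] at h
  have := congrArg (swapConj d) h
  simp only [map_mul, swapConj_swapConj] at this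
  exact this.symm

/-- The adjoint inverts `q^(H ⊗ H)`, replaces `q` by `q⁻¹` in the coefficients, changes the sign of
`q - q⁻¹` and turns `F ⊗ E` into `E ⊗ F`, which the flip undoes. What remains is `exp_q(y)
exp_{q⁻¹}(-y) = 1`. -/
theorem RPlus_mul_swapConj_conjTranspose (hs : Small γ d) :
    RPlus γ d * swapConj d (RPlus γ d)ᴴ = 1 := by
  have h0 : (qDiff γ • (spinF γ d ⊗ₖ spinE γ d)) ^ (d + 1) = 0 := by
    rw [smul_pow, kronecker_pow, spinF_pow_eq_zero (Nat.lt_succ_self d), Matrix.zero_kronecker,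
      smul_zero]
  have h : swapConj d (RPlus γ d)ᴴ = (qHH γ d)ᴴ *
      (truncSeries (fun n => star (expCoeff γ n)) d
        (-(qDiff γ • (spinF γ d ⊗ₖ spinE γ d))) * (qHH γ d)ᴴ) := by
    rw [RPlus_eq, Matrix.conjTranspose_mul, Matrix.conjTranspose_mul, conjTranspose_truncSeries,
      Matrix.conjTranspose_smul, conjTranspose_kronecker', conjTranspose_spinF hs,
      conjTranspose_spinE hs, star_qDiff, neg_smul, map_mul, map_mul, map_truncSeries, map_neg,
      map_smul, swapConj_kronecker, ← swapConj_conjTranspose, swapConj_qHH]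
  rw [h, RPlus_eq, mul_assoc, mul_assoc, ← mul_assoc (qHH γ d) ((qHH γ d)ᴴ),
    qHH_mul_conjTranspose, one_mul, ← mul_assoc (truncSeries _ _ _), truncExp_mul_truncExp_neg hs h0,
    one_mul, qHH_mul_conjTranspose]

theorem isUnit_RPlus (hs : Small γ d) : IsUnit (RPlus γ d) :=
  IsUnit.of_mul_eq_one _ (RPlus_mul_swapConj_conjTranspose hs)

theorem RMinus_eq (hs : Small γ d) : RMinus γ d = (RPlus γ d)ᴴ := by
  rw [RMinus, flip_mul_mul_flip,
    Matrix.inv_eq_right_inv (RPlus_mul_swapConj_conjTranspose hs), swapConj_swapConj]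

end TwoSites

/-! ### The Casimir operator of two sites -/

section Casimir

variable {γ : ℝ} {d : ℕ}

/-- The diagonal operator of the total index, that is, of the total weight up to a shift. -/
def levelOp (d : ℕ) : TwoSite d := Matrix.diagonal fun x => (((x.1 : ℕ) + (x.2 : ℕ) : ℕ) : ℂ)

theorem commute_diagonal_of_forall {m : Type*} [Fintype m] [DecidableEq m] {f : m → ℂ}
    {A : Matrix m m ℂ} (h : ∀ x y, A x y ≠ 0 → f x = f y) : Commute (Matrix.diagonal f) A := by
  ext x y
  rw [Matrix.diagonal_mul, Matrix.mul_diagonal]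
  by_cases hA : A x y = 0
  · simp [hA]
  · rw [h x y hA, mul_comm]

/-- Weight preservation is expressed through `levelOp` rather than `K`, because its integer
eigenvalues separate the levels also at `γ = 0` and at roots of unity. -/
theorem level_eq_of_commute {A : TwoSite d} (h : Commute (levelOp d) A) {x y}
    (hA : A x y ≠ 0) : (x.1 : ℕ) + x.2 = y.1 + y.2 := by
  have := congrFun (congrFun h.eq x) y
  rw [levelOp, Matrix.diagonal_mul, Matrix.mul_diagonal, mul_comm] at this
  exact_mod_cast mul_left_cancel₀ hA this

theorem commute_levelOp_F_E : Commute (levelOp d) (spinF γ d ⊗ₖ spinE γ d) := by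
  refine commute_diagonal_of_forall fun x y h => ?_
  rw [Matrix.kronecker_apply, spinF_apply, spinE_apply] at h
  have h1 := (ite_ne_right_iff.1 (left_ne_zero_of_mul h)).1
  have h2 := (ite_ne_right_iff.1 (right_ne_zero_of_mul h)).1
  congr 1
  omega

theorem commute_levelOp_RPlus : Commute (levelOp d) (RPlus γ d) := by
  have h : Commute (levelOp d) (qHH γ d) := Matrix.commute_diagonal _ _
  rw [RPlus_eq]
  exact (h.mul_right (semiconjBy_truncSeries (semiconjBy_smul commute_levelOp_F_E _) _ _)).mul_right h

theorem coF_apply_ne_zero {x y} (h : coF γ d x y ≠ 0) : (x.1 : ℕ) + x.2 + 1 = y.1 + y.2 := by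
  by_contra hne
  apply h
  rw [coF, Matrix.add_apply, Matrix.kronecker_apply, Matrix.kronecker_apply, spinF_apply,
    spinF_apply, spinK, spinKInv, Matrix.diagonal_apply, Matrix.diagonal_apply]
  have h1 : ¬ ((x.1 : ℕ) + 1 = y.1 ∧ x.2 = y.2) := fun ⟨a, b⟩ => hne (by rw [b]; omega)
  have h2 : ¬ ((x.2 : ℕ) + 1 = y.2 ∧ x.1 = y.1) := fun ⟨a, b⟩ => hne (by rw [b]; omega)
  split_ifs <;> simp_all

theorem coE_apply_ne_zero {x y} (h : coE γ d x y ≠ 0) : (x.1 : ℕ) + x.2 = y.1 + y.2 + 1 := by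
  rw [← transpose_coF] at h
  exact (coF_apply_ne_zero h).symm

/-- The total weight of a basis vector of the tensor square. -/
def totalWeight (d : ℕ) (x : Fin (d + 1) × Fin (d + 1)) : ℝ := weight d x.1 + weight d x.2

theorem totalWeight_eq (x : Fin (d + 1) × Fin (d + 1)) :
    totalWeight d x = ((x.1 + x.2 : ℕ) : ℝ) - d := by
  simp only [totalWeight, weight]
  push_cast
  ring

theorem kronecker_sub_left (A A' B : Matrix (Fin (d + 1)) (Fin (d + 1)) ℂ) :
    (A - A') ⊗ₖ B = A ⊗ₖ B - A' ⊗ₖ B := by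
  ext x y
  exact sub_mul _ _ _

theorem kronecker_sub_right (A B B' : Matrix (Fin (d + 1)) (Fin (d + 1)) ℂ) :
    A ⊗ₖ (B - B') = A ⊗ₖ B - A ⊗ₖ B' := by
  ext x y
  exact mul_sub _ _ _

/-- The mixed terms cancel, since the factors `q` and `q⁻¹` from reordering the two sites
compensate. The other two are added by `qNum_add`. -/
theorem co_commutator (hr : Regular γ) : coE γ d * coF γ d - coF γ d * coE γ d =
    Matrix.diagonal fun x => (qNum γ (2 * totalWeight d x) : ℂ) := by
  have h1 : (spinK γ d * spinE γ d) ⊗ₖ (spinF γ d * spinKInv γ d) =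
      (spinE γ d * spinK γ d) ⊗ₖ (spinKInv γ d * spinF γ d) := by
    rw [spinK_mul_spinE, spinF_mul_spinKInv, Matrix.kronecker_smul, Matrix.smul_kronecker,
      smul_smul, ← qPow_add]
    simp
  have h2 : (spinF γ d * spinK γ d) ⊗ₖ (spinKInv γ d * spinE γ d) =
      (spinK γ d * spinF γ d) ⊗ₖ (spinE γ d * spinKInv γ d) := by
    rw [spinF_mul_spinK, spinKInv_mul_spinE, Matrix.kronecker_smul, Matrix.smul_kronecker,
      smul_smul, ← qPow_add]
    simp
  have h3 : coE γ d * coF γ d - coF γ d * coE γ d =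
      (spinE γ d * spinF γ d - spinF γ d * spinE γ d) ⊗ₖ (spinKInv γ d * spinKInv γ d) +
      (spinK γ d * spinK γ d) ⊗ₖ (spinE γ d * spinF γ d - spinF γ d * spinE γ d) := by
    rw [kronecker_sub_left, kronecker_sub_right]
    simp only [coE, coF, mul_add, add_mul, ← Matrix.mul_kronecker_mul]
    rw [h1, h2]
    abel
  rw [h3, spin_commutator hr, spinK, spinKInv, Matrix.diagonal_mul_diagonal,
    Matrix.diagonal_mul_diagonal, Matrix.diagonal_kronecker_diagonal,
    Matrix.diagonal_kronecker_diagonal, Matrix.diagonal_add]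
  congr 1
  ext x
  rw [totalWeight, mul_add, qNum_add, ← qPow_add, ← qPow_add,
    show -weight d x.2 + -weight d x.2 = -(2 * weight d x.2) by ring, ← two_mul]
  ring

/-- The diagonal part of the Casimir operator, as a function of the weight. -/
def casimirDiag (γ : ℝ) (d : ℕ) : TwoSite d :=
  Matrix.diagonal fun x => ((qNum γ (totalWeight d x + 1 / 2) ^ 2 : ℝ) : ℂ)

/-- The Casimir operator `F E + [H + 1/2]²` of the tensor square. -/
def casimir (γ : ℝ) (d : ℕ) : TwoSite d := coF γ d * coE γ d + casimirDiag γ d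

theorem commute_casimirDiag {A : TwoSite d} (h : Commute (levelOp d) A) :
    Commute (casimirDiag γ d) A :=
  commute_diagonal_of_forall fun x y hA => by
    rw [totalWeight_eq, totalWeight_eq, level_eq_of_commute h hA]

theorem swapConj_casimirDiag : swapConj d (casimirDiag γ d) = casimirDiag γ d := by
  rw [casimirDiag, swapConj_diagonal]
  simp only [totalWeight, Prod.fst_swap, Prod.snd_swap, add_comm]

theorem transpose_casimir : (casimir γ d)ᵀ = casimir γ d := by
  rw [casimir, Matrix.transpose_add, Matrix.transpose_mul, transpose_coE, transpose_coF,
    casimirDiag, Matrix.diagonal_transpose]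

theorem conjTranspose_casimir (hs : Small γ d) : (casimir γ d)ᴴ = swapConj d (casimir γ d) := by
  rw [casimir, Matrix.conjTranspose_add, Matrix.conjTranspose_mul, conjTranspose_coE hs,
    conjTranspose_coF hs, map_add, map_mul, swapConj_casimirDiag, casimirDiag,
    Matrix.diagonal_conjTranspose]
  congr 2
  ext x
  simp

theorem commute_levelOp_casimir : Commute (levelOp d) (casimir γ d) := by
  refine Commute.add_right ?_ (Matrix.commute_diagonal _ _)
  refine commute_diagonal_of_forall fun x y h => ?_
  rw [Matrix.mul_apply] at h
  obtain ⟨z, _, hz⟩ := Finset.exists_ne_zero_of_sum_ne_zero h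
  have h1 := coF_apply_ne_zero (left_ne_zero_of_mul hz)
  have h2 := coE_apply_ne_zero (right_ne_zero_of_mul hz)
  congr 1
  omega

/-- Moving `F` to the left costs `[2H]` in `E F = F E + [2H]` and turns `[H + 1/2]²` into `[H -
1/2]²`; the difference of these squares is exactly `[2H]`. -/
theorem commute_casimir_coF (hr : Regular γ) : Commute (casimir γ d) (coF γ d) := by
  have h : casimirDiag γ d * coF γ d = coF γ d * Matrix.diagonal fun x =>
      ((qNum γ (totalWeight d x - 1 / 2) ^ 2 : ℝ) : ℂ) := by
    ext x y
    rw [casimirDiag, Matrix.diagonal_mul, Matrix.mul_diagonal]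
    by_cases h0 : coF γ d x y = 0
    · simp [h0]
    · rw [totalWeight_eq, totalWeight_eq, ← coF_apply_ne_zero h0, mul_comm]
      push_cast
      congr 4
      ring
  have h' := eq_add_of_sub_eq (co_commutator (d := d) hr)
  rw [Commute, SemiconjBy, casimir, add_mul, mul_add, mul_assoc, h', h, mul_add, add_assoc,
    add_comm (coF γ d * (coF γ d * coE γ d)), ← add_assoc, ← mul_add, Matrix.diagonal_add, add_comm,
    casimirDiag]
  congr 3
  ext x
  have := qNum_sq_sub_sq γ (totalWeight d x + 1 / 2) (totalWeight d x - 1 / 2)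
  rw [show totalWeight d x + 1 / 2 - (totalWeight d x - 1 / 2) = 1 by ring, qNum_one hr, mul_one,
    show totalWeight d x + 1 / 2 + (totalWeight d x - 1 / 2) = 2 * totalWeight d x by ring] at this
  rw [← this]
  push_cast
  ring

theorem RPlus_semiconj_casimir (hs : Small γ d) :
    SemiconjBy (RPlus γ d) (casimir γ d) (swapConj d (casimir γ d)) := by
  rw [casimir, map_add, map_mul, swapConj_casimirDiag]
  exact ((RPlus_semiconj_coF hs).mul_right (RPlus_semiconj_coE hs)).add_right
    (commute_casimirDiag commute_levelOp_RPlus).symm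

end Casimir

/-! ### Operators on the chain -/

section Embedding

variable {N d : ℕ}

/-- The operator on the chain that acts as `A` at the site `n`. -/
def site (A : Matrix (Fin (d + 1)) (Fin (d + 1)) ℂ) (n : Fin N) : Chain N d := fun x y =>
  if ∀ j, j ≠ n → x j = y j then A (x n) (y n) else 0

theorem site_mul_apply (A : Matrix (Fin (d + 1)) (Fin (d + 1)) ℂ) (n : Fin N) (X : Chain N d)
    (x y : Fin N → Fin (d + 1)) :
    (site A n * X) x y = ∑ i, A (x n) i * X (Function.update x n i) y := by
  rw [Matrix.mul_apply]
  symm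
  refine Finset.sum_of_injOn (Function.update x n) ?_ ?_ ?_ ?_
  · intro i _ j _ h
    simpa using congrFun h n
  · simp
  · intro z _ hz
    rw [site, if_neg, zero_mul]
    intro h
    refine hz ⟨z n, by simp, ?_⟩
    ext j
    by_cases hj : j = n
    · subst hj; simp
    · simp [hj, h j hj]
  · intro i _
    rw [site, if_pos fun j hj => by simp [hj], Function.update_self]

theorem site_mul (A B : Matrix (Fin (d + 1)) (Fin (d + 1)) ℂ) (n : Fin N) :
    site (A * B) n = site A n * site B n := by
  ext x y
  rw [site_mul_apply]
  simp only [site, Function.update_self]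
  have : ∀ i, (∀ j, j ≠ n → Function.update x n i j = y j) ↔ ∀ j, j ≠ n → x j = y j := fun i =>
    forall_congr' fun j => imp_congr_right fun hj => by rw [Function.update_of_ne hj]
  simp only [this]
  split_ifs
  · rfl
  · simp

theorem site_zero (n : Fin N) : site (0 : Matrix (Fin (d + 1)) (Fin (d + 1)) ℂ) n = 0 := by
  ext x y
  simp [site]

theorem site_one (n : Fin N) : site (1 : Matrix (Fin (d + 1)) (Fin (d + 1)) ℂ) n = 1 := by
  ext x y
  by_cases h : x = y
  · subst h; simp [site]
  · rw [Matrix.one_apply_ne h, site]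
    split_ifs with h1
    · refine Matrix.one_apply_ne fun h2 => h (funext fun j => ?_)
      by_cases hj : j = n
      · rw [hj, h2]
      · exact h1 j hj
    · rfl

theorem site_pow (A : Matrix (Fin (d + 1)) (Fin (d + 1)) ℂ) (n : Fin N) (k : ℕ) :
    site A n ^ k = site (A ^ k) n := by
  induction k with
  | zero => rw [pow_zero, pow_zero, site_one]
  | succ k ih => rw [pow_succ, ih, ← site_mul, ← pow_succ]

theorem embed_kronecker (A B : Matrix (Fin (d + 1)) (Fin (d + 1)) ℂ) {a b : Fin N} (h : a ≠ b) :
    embed (A ⊗ₖ B) a b = site A a * site B b := by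
  ext x y
  rw [site_mul_apply, Finset.sum_eq_single (y a)]
  · simp only [embed, site, Matrix.kronecker_apply, Function.update_of_ne h.symm]
    have : (∀ j, j ≠ b → Function.update x a (y a) j = y j) ↔
        ∀ j, j ≠ a → j ≠ b → x j = y j := by
      refine forall_congr' fun j => ?_
      by_cases hj : j = a
      · subst hj; simp
      · simp [hj]
    simp only [this, mul_ite, mul_zero]
  · intro i _ hi
    rw [site, if_neg, mul_zero]
    intro h'
    exact hi (by simpa using h' a h)
  · simp

theorem site_commute (A B : Matrix (Fin (d + 1)) (Fin (d + 1)) ℂ) {a b : Fin N} (h : a ≠ b) :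
    Commute (site A a) (site B b) := by
  rw [Commute, SemiconjBy, ← embed_kronecker A B h, ← embed_kronecker B A h.symm]
  ext x y
  simp only [embed, Matrix.kronecker_apply]
  rw [mul_comm]
  congr 1
  exact propext (forall_congr' fun j => ⟨fun h a b => h b a, fun h a b => h b a⟩)

theorem embed_add (A B : TwoSite d) (a b : Fin N) : embed (A + B) a b = embed A a b + embed B a b := by
  ext x y
  simp only [embed, Matrix.add_apply]
  split_ifs <;> simp

/-- Matrix units are Kronecker products, so additive statements about `embed` reduce to products of
one-site operators. -/
theorem twoSite_induction {p : TwoSite d → Prop} (hk : ∀ A B, p (A ⊗ₖ B))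
    (hadd : ∀ A B, p A → p B → p (A + B)) (A : TwoSite d) : p A := by
  refine A.induction_on (fun A B => hadd A B) fun i j c => ?_
  have : Matrix.single i j c = Matrix.single i.1 j.1 c ⊗ₖ Matrix.single i.2 j.2 1 := by
    rw [Matrix.single_kronecker_single, mul_one]
  rw [this]
  exact hk _ _

theorem embed_mul (A B : TwoSite d) {a b : Fin N} (h : a ≠ b) :
    embed (A * B) a b = embed A a b * embed B a b := by
  induction A using twoSite_induction with
  | hadd A A' h1 h2 => rw [add_mul, embed_add, embed_add, add_mul, h1, h2]
  | hk A A' =>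
    induction B using twoSite_induction with
    | hadd B B' h1 h2 => rw [mul_add, embed_add, embed_add, mul_add, h1, h2]
    | hk B B' =>
      rw [← Matrix.mul_kronecker_mul, embed_kronecker _ _ h, embed_kronecker _ _ h,
        embed_kronecker _ _ h, site_mul, site_mul,
        (site_commute A' B h.symm).mul_mul_mul_comm]

/-- The embedding of the operators on two sites as an algebra homomorphism. -/
def embedHom {a b : Fin N} (h : a ≠ b) : TwoSite d →ₐ[ℂ] Chain N d where
  toFun A := embed A a b
  map_one' := by
    rw [← Matrix.one_kronecker_one, embed_kronecker _ _ h, site_one, site_one, one_mul]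
  map_mul' A B := embed_mul A B h
  map_zero' := by
    ext x y
    simp [embed]
  map_add' A B := embed_add A B a b
  commutes' c := by
    have hs : ∀ A : TwoSite d, embed (c • A) a b = c • embed A a b := fun A => by
      ext x y
      simp [embed]
    rw [Algebra.algebraMap_eq_smul_one, Algebra.algebraMap_eq_smul_one, hs,
      ← Matrix.one_kronecker_one, embed_kronecker _ _ h, site_one, site_one, one_mul]

theorem embedHom_apply {a b : Fin N} (h : a ≠ b) (A : TwoSite d) : embedHom h A = embed A a b := rfl

theorem embed_semiconj {A B C : TwoSite d} {a b : Fin N} (h : a ≠ b) (hs : SemiconjBy A B C) :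
    SemiconjBy (embed A a b) (embed B a b) (embed C a b) := hs.map (embedHom h)

theorem embed_swapConj (A : TwoSite d) (a b : Fin N) : embed (swapConj d A) a b = embed A b a := by
  ext x y
  simp only [embed, swapConj_apply, Prod.swap]
  congr 1
  exact propext (forall_congr' fun j => ⟨fun h a b => h b a, fun h a b => h b a⟩)

theorem embed_transpose (A : TwoSite d) (a b : Fin N) : (embed A a b)ᵀ = embed Aᵀ a b := by
  ext x y
  simp only [embed, Matrix.transpose_apply, eq_comm]

theorem embed_conjTranspose (A : TwoSite d) (a b : Fin N) : (embed A a b)ᴴ = embed Aᴴ a b := by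
  ext x y
  simp only [embed, Matrix.conjTranspose_apply, apply_ite star, star_zero, eq_comm]

theorem embed_commute_site (A : TwoSite d) (B : Matrix (Fin (d + 1)) (Fin (d + 1)) ℂ)
    {a b c : Fin N} (hab : a ≠ b) (hac : a ≠ c) (hbc : b ≠ c) :
    Commute (embed A a b) (site B c) := by
  induction A using twoSite_induction with
  | hadd A A' h1 h2 => rw [embed_add]; exact h1.add_left h2
  | hk A A' =>
    rw [embed_kronecker _ _ hab]
    exact (site_commute _ _ hac).mul_left (site_commute _ _ hbc)

theorem embed_commute_embed (A B : TwoSite d) {a b c e : Fin N} (hab : a ≠ b) (hce : c ≠ e)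
    (hac : a ≠ c) (hae : a ≠ e) (hbc : b ≠ c) (hbe : b ≠ e) :
    Commute (embed A a b) (embed B c e) := by
  induction B using twoSite_induction with
  | hadd B B' h1 h2 => rw [embed_add]; exact h1.add_right h2
  | hk B B' =>
    rw [embed_kronecker _ _ hce]
    exact (embed_commute_site A B hab hac hbc).mul_right (embed_commute_site A B' hab hae hbe)

theorem embed_diagonal (f : Fin (d + 1) × Fin (d + 1) → ℂ) (a b : Fin N) :
    embed (Matrix.diagonal f) a b = Matrix.diagonal fun x => f (x a, x b) := by
  ext x y
  by_cases h : x = y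
  · subst h; simp [embed]
  · rw [Matrix.diagonal_apply_ne _ h, embed]
    split_ifs with h1
    · refine Matrix.diagonal_apply_ne _ fun h2 => h (funext fun j => ?_)
      by_cases ha : j = a
      · rw [ha]; exact congrArg Prod.fst h2
      by_cases hb : j = b
      · rw [hb]; exact congrArg Prod.snd h2
      exact h1 j ha hb
    · rfl

end Embedding

/-! ### Fusion of R-matrices and the Yang–Baxter equation -/

section Fusion

variable {N d : ℕ} {γ : ℝ}

/-- The diagonal factor `q ^ ((H_a + H_b) H_c)`. -/
def fusedDiag (γ : ℝ) (d : ℕ) (a b c : Fin N) : Chain N d :=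
  embed (qHH γ d) a c * embed (qHH γ d) b c

theorem fusedDiag_eq (a b c : Fin N) : fusedDiag γ d a b c = Matrix.diagonal fun x =>
    qPow γ (totalWeight d (x a, x b) * weight d (x c)) := by
  rw [fusedDiag, qHH, embed_diagonal, embed_diagonal, Matrix.diagonal_mul_diagonal]
  congr 1
  ext x
  rw [← qPow_add, totalWeight, add_mul]

theorem fusedDiag_comm (a b c : Fin N) : fusedDiag γ d a b c = fusedDiag γ d b a c := by
  simp only [fusedDiag_eq, totalWeight, add_comm]

theorem commute_fusedDiag {A : TwoSite d} (h : Commute (levelOp d) A) {a b c : Fin N}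
    (hac : a ≠ c) (hbc : b ≠ c) : Commute (fusedDiag γ d a b c) (embed A a b) := by
  rw [fusedDiag_eq]
  refine commute_diagonal_of_forall fun x y hA => ?_
  obtain ⟨h1, h2⟩ := ite_ne_right_iff.1 hA
  rw [h1 c hac.symm hbc.symm, totalWeight_eq, totalWeight_eq, level_eq_of_commute h h2]

/-- This is `(Δ ⊗ 1) R = R_{ac} R_{bc}`. Collecting the diagonal factors outside turns the two
exponents into multiples of `F ⊗ K⁻¹ ⊗ E` and `K ⊗ F ⊗ E`; these q-commute, and their sum is a
multiple of `Δ(F) ⊗ E`. -/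
theorem RPlus_fusion (hs : Small γ d) {a b c : Fin N} (hab : a ≠ b) (hac : a ≠ c) (hbc : b ≠ c) :
    embed (RPlus γ d) a c * embed (RPlus γ d) b c =
      fusedDiag γ d a b c *
        truncSeries (expCoeff γ) d (qDiff γ • (embed (coF γ d) a b * site (spinE γ d) c)) *
        fusedDiag γ d a b c := by
  have hR : ∀ {a c : Fin N}, a ≠ c → embed (RPlus γ d) a c = embed (qHH γ d) a c *
      truncSeries (expCoeff γ) d (qDiff γ • (site (spinF γ d) a * site (spinE γ d) c)) *
      embed (qHH γ d) a c := by
    intro a c h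
    rw [← embed_kronecker _ _ h, ← embedHom_apply h, ← embedHom_apply h, ← embedHom_apply h,
      ← map_smul, ← map_truncSeries, ← map_mul, ← map_mul, RPlus_eq]
  set F := spinF γ d
  set E := spinE γ d
  set K := spinK γ d
  set K' := spinKInv γ d
  set Da := embed (qHH γ d) a c with hDa
  set Db := embed (qHH γ d) b c with hDb
  have hD : Commute Da Db := by
    rw [hDa, hDb, qHH, embed_diagonal, embed_diagonal]
    exact Matrix.commute_diagonal _ _
  set U := embed (F ⊗ₖ K') a b with hU
  set V := embed (K ⊗ₖ F) a b with hV
  set u := qDiff γ • (U * site E c) with hu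
  set v := qDiff γ • (V * site E c) with hv
  have hUE : Commute U (site E c) := embed_commute_site _ _ hab hac hbc
  have hVE : Commute V (site E c) := embed_commute_site _ _ hab hac hbc
  have h1 : SemiconjBy Db u (qDiff γ • (site F a * site E c)) := by
    rw [hu, hU, embed_kronecker _ _ hab, mul_assoc]
    refine semiconjBy_smul (SemiconjBy.mul_right ?_ ?_) _
    · exact embed_commute_site _ _ hbc hab.symm hac.symm
    · have := embed_semiconj hbc (qHH_semiconj_KInv_E (γ := γ) (d := d))
      rwa [embed_kronecker _ _ hbc, embed_kronecker _ _ hbc, site_one, one_mul] at this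
  have h2 : SemiconjBy Da (qDiff γ • (site F b * site E c)) v := by
    rw [hv, hV, embed_kronecker _ _ hab, (site_commute K F hab).eq, mul_assoc]
    refine semiconjBy_smul (SemiconjBy.mul_right ?_ ?_) _
    · exact embed_commute_site _ _ hac hab hbc.symm
    · have := embed_semiconj hac (qHH_semiconj_one_E (γ := γ) (d := d))
      rwa [embed_kronecker _ _ hac, embed_kronecker _ _ hac, site_one, one_mul] at this
  have hsum : u + v = qDiff γ • (embed (coF γ d) a b * site E c) := by
    rw [hu, hv, ← smul_add, ← add_mul, coF, embed_add]
  have hUV : V * U = qPow γ (-2) • (U * V) := by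
    have h3 : (K ⊗ₖ F) * (F ⊗ₖ K') = qPow γ (-2) • ((F ⊗ₖ K') * (K ⊗ₖ F)) := by
      rw [← Matrix.mul_kronecker_mul, ← Matrix.mul_kronecker_mul, spinF_mul_spinK,
        spinF_mul_spinKInv, Matrix.kronecker_smul, Matrix.smul_kronecker, smul_smul, ← qPow_add]
      norm_num
      rfl
    rw [hU, hV, ← embed_mul _ _ hab, ← embed_mul _ _ hab, h3, ← embedHom_apply hab, map_smul,
      embedHom_apply]
  have huv : v * u = qPow γ (-2) • (u * v) := by
    rw [hu, hv, smul_mul_smul_comm, smul_mul_smul_comm, hUE.symm.mul_mul_mul_comm,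
      hVE.symm.mul_mul_mul_comm, hUV, smul_mul_assoc, smul_comm]
  -- Both `u` and `v` carry one factor `E` at the site `c`, so the product contains `E^(k + l)`
  -- there.
  have hzero : ∀ k l, d < k + l → u ^ k * v ^ l = 0 := by
    intro k l hkl
    rw [hu, hv, smul_pow, smul_pow, hUE.mul_pow, hVE.mul_pow, smul_mul_smul_comm,
      ((hVE.symm).pow_pow k l).mul_mul_mul_comm, ← pow_add,
      ← pow_add (site E c), site_pow, spinE_pow_eq_zero hkl,
      site_zero, mul_zero, smul_zero]
  have h1' := semiconjBy_truncSeries h1 (expCoeff γ) d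
  have h2' := semiconjBy_truncSeries h2 (expCoeff γ) d
  rw [hR hac, hR hbc, ← hsum, ← truncExp_mul_truncExp hs huv hzero]
  change Da * _ * Da * (Db * _ * Db) = Da * Db * (_ * _) * (Da * Db)
  calc _ = Da * (truncSeries (expCoeff γ) d (qDiff γ • (site F a * site E c)) * (Da * Db)) *
        truncSeries (expCoeff γ) d (qDiff γ • (site F b * site E c)) * Db := by
        simp only [mul_assoc]
    _ = Da * (truncSeries (expCoeff γ) d (qDiff γ • (site F a * site E c)) * Db) *
        (Da * truncSeries (expCoeff γ) d (qDiff γ • (site F b * site E c))) * Db := by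
        rw [hD.eq]
        simp only [mul_assoc]
    _ = _ := by
        rw [← h1'.eq, h2'.eq]
        simp only [mul_assoc]

/-- The properties of an R-matrix from which the metric operators inherit theirs; `C` is the
Casimir operator. -/
structure IsRMatrix (N : ℕ) (C R : TwoSite d) : Prop where
  semiconj : SemiconjBy R C (swapConj d C)
  yangBaxter : ∀ {a b c : Fin N}, a ≠ b → a ≠ c → b ≠ c →
    embed R a b * embed R a c * embed R b c = embed R b c * embed R a c * embed R a b
  commute_first : ∀ {a b c : Fin N}, a ≠ b → a ≠ c → b ≠ c →
    Commute (embed R a c * embed R b c) (embed C a b)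
  commute_second : ∀ {a b c : Fin N}, a ≠ b → a ≠ c → b ≠ c →
    Commute (embed R c b * embed R c a) (embed C a b)

/-- In the fused form the sites `a, b` enter only through `Δ(F)` and the total weight, with both of
which the Casimir operator commutes. -/
theorem RPlus_commute_first (hs : Small γ d) {a b c : Fin N} (hab : a ≠ b) (hac : a ≠ c)
    (hbc : b ≠ c) : Commute (embed (RPlus γ d) a c * embed (RPlus γ d) b c)
      (embed (casimir γ d) a b) := by
  have hD : Commute (embed (casimir γ d) a b) (fusedDiag γ d a b c) :=
    (commute_fusedDiag commute_levelOp_casimir hac hbc).symm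
  rw [RPlus_fusion hs hab hac hbc]
  refine Commute.symm ((hD.mul_right (semiconjBy_truncSeries (semiconjBy_smul ?_ _) _ _)).mul_right
    hD)
  exact SemiconjBy.mul_right (embed_semiconj hab (commute_casimir_coF hs.regular))
    (embed_commute_site _ _ hab hac hbc)

/-- `R_{ab}` turns `Δ(F)` into its opposite, that is, the fused `R_{ac} R_{bc}` into the fused
`R_{bc} R_{ac}`; the diagonal factor is symmetric in `a, b`. -/
theorem RPlus_yangBaxter (hs : Small γ d) {a b c : Fin N} (hab : a ≠ b) (hac : a ≠ c)
    (hbc : b ≠ c) :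
    embed (RPlus γ d) a b * embed (RPlus γ d) a c * embed (RPlus γ d) b c =
      embed (RPlus γ d) b c * embed (RPlus γ d) a c * embed (RPlus γ d) a b := by
  have hD : Commute (embed (RPlus γ d) a b) (fusedDiag γ d a b c) :=
    (commute_fusedDiag commute_levelOp_RPlus hac hbc).symm
  rw [mul_assoc, RPlus_fusion hs hab hac hbc, RPlus_fusion hs hab.symm hbc hac,
    fusedDiag_comm b a c]
  have hF : SemiconjBy (embed (RPlus γ d) a b) (embed (coF γ d) a b * site (spinE γ d) c)
      (embed (coF γ d) b a * site (spinE γ d) c) := by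
    refine SemiconjBy.mul_right ?_ (embed_commute_site _ _ hab hac hbc)
    rw [← embed_swapConj _ a b]
    exact embed_semiconj hab (RPlus_semiconj_coF hs)
  have hexp := semiconjBy_truncSeries (semiconjBy_smul hF (qDiff γ)) (expCoeff γ) d
  exact (SemiconjBy.mul_right (SemiconjBy.mul_right hD hexp) hD).eq

theorem isRMatrix_RPlus (hs : Small γ d) : IsRMatrix N (casimir γ d) (RPlus γ d) where
  semiconj := RPlus_semiconj_casimir hs
  yangBaxter := RPlus_yangBaxter hs
  commute_first := RPlus_commute_first hs
  commute_second := by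
    intro a b c hab hac hbc
    -- Transposition reverses the product and turns `R_{ac}` into `R_{ca}`, which moves the third
    -- site to the first index.
    have h := congrArg Matrix.transpose (RPlus_commute_first hs hab hac hbc).eq
    simp only [Matrix.transpose_mul, embed_transpose, transpose_RPlus, transpose_casimir,
      embed_swapConj] at h
    exact h.symm

/-- Every property is the adjoint of the one for `R⁺`. The adjoint reverses products and exchanges
`C_{ab}` with `C_{ba}`, so the commutation properties are taken with `a` and `b` interchanged. -/
theorem isRMatrix_RMinus (hs : Small γ d) : IsRMatrix N (casimir γ d) (RMinus γ d) where
  semiconj := by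
    have h := congrArg Matrix.conjTranspose (RPlus_semiconj_casimir hs).eq
    rw [Matrix.conjTranspose_mul, Matrix.conjTranspose_mul, swapConj_conjTranspose,
      conjTranspose_casimir hs, swapConj_swapConj, ← RMinus_eq hs] at h
    exact h.symm
  yangBaxter := by
    intro a b c hab hac hbc
    have h := congrArg Matrix.conjTranspose (RPlus_yangBaxter hs hab hac hbc)
    simp only [Matrix.conjTranspose_mul, embed_conjTranspose, ← RMinus_eq hs] at h
    simpa only [mul_assoc] using h.symm
  commute_first := by
    intro a b c hab hac hbc
    have h := congrArg Matrix.conjTranspose (RPlus_commute_first hs hab.symm hbc hac).eq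
    simp only [Matrix.conjTranspose_mul, embed_conjTranspose, ← RMinus_eq hs,
      conjTranspose_casimir hs, embed_swapConj] at h
    exact h.symm
  commute_second := by
    intro a b c hab hac hbc
    have h := congrArg Matrix.conjTranspose
      ((isRMatrix_RPlus hs).commute_second hab.symm hbc hac).eq
    simp only [Matrix.conjTranspose_mul, embed_conjTranspose, ← RMinus_eq hs,
      conjTranspose_casimir hs, embed_swapConj] at h
    exact h.symm

end Fusion

/-! ### Ordered products over pairs of sites -/

section OrderedProducts

variable {ι M : Type*} [Monoid M] {r : ι → ι → M}

/-- The product of the `r j z`, `j ∈ l`, in the reverse of the order of the list. -/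
def leftProd (r : ι → ι → M) (l : List ι) (z : ι) : M := (l.reverse.map fun j => r j z).prod

/-- The product of the `r y j`, `j ∈ l`, in the order of the list. -/
def rightProd (r : ι → ι → M) (y : ι) (l : List ι) : M := (l.map fun j => r y j).prod

/-- The product of the `r j z`, `j ∈ l`, in the order of the list. -/
def columnProd (r : ι → ι → M) (l : List ι) (z : ι) : M := (l.map fun j => r j z).prod

theorem leftProd_cons (y : ι) (l : List ι) (z : ι) :
    leftProd r (y :: l) z = leftProd r l z * r y z := by
  simp [leftProd]

theorem leftProd_append (l l' : List ι) (z : ι) :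
    leftProd r (l ++ l') z = leftProd r l' z * leftProd r l z := by
  simp [leftProd]

theorem rightProd_cons (y x : ι) (l : List ι) :
    rightProd r y (x :: l) = r y x * rightProd r y l := by
  simp [rightProd]

theorem commute_leftProd {x : M} {l : List ι} {z : ι} (h : ∀ j ∈ l, Commute x (r j z)) :
    Commute x (leftProd r l z) :=
  Commute.list_prod_right _ _ (by simpa using h)

theorem commute_rightProd {x : M} {l : List ι} {y : ι} (h : ∀ j ∈ l, Commute x (r y j)) :
    Commute x (rightProd r y l) :=
  Commute.list_prod_right _ _ (by simpa using h)

/-- Elements attached to disjoint pairs of sites commute. -/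
def DisjointCommute (r : ι → ι → M) : Prop :=
  ∀ a b c e : ι, a ≠ b → c ≠ e → a ≠ c → a ≠ e → b ≠ c → b ≠ e → Commute (r a b) (r c e)

/-- The train argument: each `w` in the list gives one Yang–Baxter move on `y, w, z`, and the other
factors involved commute by disjointness. -/
theorem leftProd_mul_rightProd (hc : DisjointCommute r)
    (hyb : ∀ a b c : ι, a ≠ b → a ≠ c → b ≠ c → r a b * r a c * r b c = r b c * r a c * r a b)
    {y z : ι} (hyz : y ≠ z) {l : List ι} (hl : l.Nodup) (hy : y ∉ l) (hz : z ∉ l) :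
    leftProd r l z * r y z * rightProd r y l = rightProd r y l * r y z * leftProd r l z := by
  induction l with
  | nil => simp [leftProd, rightProd]
  | cons w l ih =>
    obtain ⟨hwl, hl⟩ := List.nodup_cons.1 hl
    obtain ⟨hyw, hyl⟩ := not_or.1 (List.mem_cons.not.1 hy)
    obtain ⟨hzw, hzl⟩ := not_or.1 (List.mem_cons.not.1 hz)
    have h1 : Commute (r y w) (leftProd r l z) := commute_leftProd fun j hj =>
      hc _ _ _ _ hyw (fun e => hzl (e ▸ hj)) (fun e => hyl (e ▸ hj)) hyz (fun e => hwl (e ▸ hj))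
        (Ne.symm hzw)
    have h2 : Commute (r w z) (rightProd r y l) := commute_rightProd fun j hj =>
      hc _ _ _ _ (Ne.symm hzw) (fun e => hyl (e ▸ hj)) (Ne.symm hyw) (fun e => hwl (e ▸ hj))
        (Ne.symm hyz) (fun e => hzl (e ▸ hj))
    rw [leftProd_cons, rightProd_cons]
    calc leftProd r l z * r w z * r y z * (r y w * rightProd r y l)
        = leftProd r l z * (r w z * r y z * r y w) * rightProd r y l := by simp only [mul_assoc]
      _ = (leftProd r l z * r y w) * r y z * (r w z * rightProd r y l) := by
          rw [← hyb y w z hyw hyz (Ne.symm hzw)]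
          simp only [mul_assoc]
      _ = r y w * (leftProd r l z * r y z * rightProd r y l) * r w z := by
          rw [← h1.eq, h2.eq]
          simp only [mul_assoc]
      _ = _ := by
          rw [ih hl hyl hzl]
          simp only [mul_assoc]

/-- By disjointness the two products interleave into the pairs `r y b * r y a`, each of which
commutes with `x`. -/
theorem commute_leftProd_mul_leftProd (hc : DisjointCommute r) {a b : ι} (hab : a ≠ b) {x : M}
    {l : List ι} (hl : l.Nodup) (ha : a ∉ l) (hb : b ∉ l)
    (hx : ∀ y ∈ l, Commute (r y b * r y a) x) :
    Commute (leftProd r l b * leftProd r l a) x := by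
  induction l with
  | nil => simp [leftProd]
  | cons y l ih =>
    obtain ⟨hyl, hl⟩ := List.nodup_cons.1 hl
    obtain ⟨hay, hal⟩ := not_or.1 (List.mem_cons.not.1 ha)
    obtain ⟨hby, hbl⟩ := not_or.1 (List.mem_cons.not.1 hb)
    have h1 : Commute (r y b) (leftProd r l a) := commute_leftProd fun j hj =>
      hc _ _ _ _ (Ne.symm hby) (fun e => hal (e ▸ hj)) (fun e => hyl (e ▸ hj)) (Ne.symm hay)
        (fun e => hbl (e ▸ hj)) hab.symm
    rw [leftProd_cons, leftProd_cons, h1.mul_mul_mul_comm]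
    exact (ih hl hal hbl fun w hw => hx w (List.mem_cons_of_mem _ hw)).mul_left
      (hx y List.mem_cons_self)

variable [LinearOrder ι]

/-- The product of the `leftProd`s over the sites of a list, in the reverse order. -/
def listEta (r : ι → ι → M) (l : List ι) : M :=
  (l.reverse.map fun n => leftProd r (l.filter (fun j => j < n)) n).prod

/-- The product of the `rightProd`s over the sites of a list. -/
def listEtaOp (r : ι → ι → M) (l : List ι) : M :=
  (l.map fun n => rightProd r n (l.filter (fun j => n < j))).prod

theorem listEta_append_singleton {l : List ι} {z : ι} (h : (l ++ [z]).Pairwise (· < ·)) :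
    listEta r (l ++ [z]) = leftProd r l z * listEta r l := by
  have hz : ∀ x ∈ l, x < z := fun x hx =>
    (List.pairwise_append.1 h).2.2 x hx z (List.mem_singleton_self z)
  rw [listEta, List.reverse_append, List.reverse_singleton, List.singleton_append, List.map_cons,
    List.prod_cons, listEta]
  congr 1
  · rw [List.filter_append, List.filter_eq_self.2 (by simpa using hz)]
    simp
  · refine congrArg List.prod (List.map_congr_left fun n hn => ?_)
    have := (hz n (List.mem_reverse.1 hn)).le
    rw [List.filter_append]
    simp [this]

theorem listEtaOp_cons {y : ι} {l : List ι} (h : (y :: l).Pairwise (· < ·)) :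
    listEtaOp r (y :: l) = rightProd r y l * listEtaOp r l := by
  have hy : ∀ x ∈ l, y < x := (List.pairwise_cons.1 h).1
  rw [listEtaOp, List.map_cons, List.prod_cons, listEtaOp]
  congr 1
  · rw [List.filter_cons, List.filter_eq_self.2 (by simpa using hy)]
    simp
  · refine congrArg List.prod (List.map_congr_left fun n hn => ?_)
    rw [List.filter_cons, if_neg (by simpa using (hy n hn).le)]

theorem commute_listEta {x : M} {l : List ι} (h : ∀ i ∈ l, ∀ j ∈ l, i < j → Commute x (r i j)) :
    Commute x (listEta r l) := by
  refine Commute.list_prod_right _ _ ?_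
  simp only [List.mem_map, List.mem_reverse, forall_exists_index, and_imp, forall_apply_eq_imp_iff₂]
  exact fun n hn => commute_leftProd fun j hj =>
    h j (List.mem_filter.1 hj).1 n hn (by simpa using (List.mem_filter.1 hj).2)

theorem commute_listEtaOp {x : M} {l : List ι} (h : ∀ i ∈ l, ∀ j ∈ l, i < j → Commute x (r i j)) :
    Commute x (listEtaOp r l) := by
  refine Commute.list_prod_right _ _ ?_
  simp only [List.mem_map, forall_exists_index, and_imp, forall_apply_eq_imp_iff₂]
  exact fun n hn => commute_rightProd fun j hj =>
    h n hn j (List.mem_filter.1 hj).1 (by simpa using (List.mem_filter.1 hj).2)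

/-- The last factor `r y z` of each row is disjoint from all later rows restricted to `l`, so these
factors can be collected on the right. -/
theorem listEtaOp_append_singleton (hc : DisjointCommute r) {l : List ι} {z : ι}
    (h : (l ++ [z]).Pairwise (· < ·)) :
    listEtaOp r (l ++ [z]) = listEtaOp r l * columnProd r l z := by
  induction l with
  | nil => simp [listEtaOp, columnProd, rightProd]
  | cons y l ih =>
    rw [List.cons_append] at h
    obtain ⟨hy, hl⟩ := List.pairwise_cons.1 h
    have hlz := List.pairwise_append.1 hl
    have hz : ∀ j ∈ l, j < z := fun j hj => hlz.2.2 j hj z (List.mem_singleton_self z)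
    have hyz : y < z := hy z (by simp)
    have hyl : ∀ j ∈ l, y < j := fun j hj => hy j (by simp [hj])
    have hcom : Commute (r y z) (listEtaOp r l) := commute_listEtaOp fun i hi j hj hij =>
      hc _ _ _ _ hyz.ne hij.ne (hyl i hi).ne (hyl j hj).ne (hz i hi).ne' (hz j hj).ne'
    rw [List.cons_append, listEtaOp_cons h, ih hl,
      listEtaOp_cons (List.pairwise_cons.2 ⟨hyl, hlz.1⟩)]
    have e1 : rightProd r y (l ++ [z]) = rightProd r y l * r y z := by simp [rightProd]
    have e2 : columnProd r (y :: l) z = r y z * columnProd r l z := by simp [columnProd]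
    rw [e1, e2, mul_assoc, ← mul_assoc (r y z), hcom.eq]
    simp only [mul_assoc]

/-- Passing the column of `z` through the rows one at a time by the train argument reverses its
order. -/
theorem leftProd_mul_listEtaOp (hc : DisjointCommute r)
    (hyb : ∀ a b c : ι, a ≠ b → a ≠ c → b ≠ c → r a b * r a c * r b c = r b c * r a c * r a b)
    {l : List ι} {z : ι} (h : (l ++ [z]).Pairwise (· < ·)) :
    leftProd r l z * listEtaOp r l = listEtaOp r l * columnProd r l z := by
  induction l with
  | nil => simp [listEtaOp, columnProd, leftProd]
  | cons y l ih =>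
    rw [List.cons_append] at h
    obtain ⟨hy, hl⟩ := List.pairwise_cons.1 h
    have hlz := List.pairwise_append.1 hl
    have hz : ∀ j ∈ l, j < z := fun j hj => hlz.2.2 j hj z (List.mem_singleton_self z)
    have hyz : y < z := hy z (by simp)
    have hyl : ∀ j ∈ l, y < j := fun j hj => hy j (by simp [hj])
    have hcom : Commute (r y z) (listEtaOp r l) := commute_listEtaOp fun i hi j hj hij =>
      hc _ _ _ _ hyz.ne hij.ne (hyl i hi).ne (hyl j hj).ne (hz i hi).ne' (hz j hj).ne'
    have e2 : columnProd r (y :: l) z = r y z * columnProd r l z := by simp [columnProd]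
    rw [listEtaOp_cons (List.pairwise_cons.2 ⟨hyl, hlz.1⟩), leftProd_cons, e2, ← mul_assoc,
      leftProd_mul_rightProd hc hyb hyz.ne (hlz.1.imp fun h => h.ne)
        (fun h => (hyl y h).false) (fun h => (hz z h).false), mul_assoc, ih hl,
      mul_assoc, ← mul_assoc (r y z), hcom.eq]
    simp only [mul_assoc]

theorem listEta_eq_listEtaOp (hc : DisjointCommute r)
    (hyb : ∀ a b c : ι, a ≠ b → a ≠ c → b ≠ c → r a b * r a c * r b c = r b c * r a c * r a b)
    {l : List ι} (h : l.Pairwise (· < ·)) : listEta r l = listEtaOp r l := by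
  induction l using List.reverseRecOn with
  | nil => rfl
  | append_singleton l z ih =>
    rw [listEta_append_singleton h, ih (List.pairwise_append.1 h).1,
      leftProd_mul_listEtaOp hc hyb h, listEtaOp_append_singleton hc h]

/-- The star reverses each column, and `listEtaOp_append_singleton` reads the result as the opposite
ordered product. No Yang–Baxter equation enters. -/
theorem star_listEta {M : Type*} [Monoid M] [StarMul M] {r r' : ι → ι → M}
    (hc : DisjointCommute r') (hr : ∀ a b, star (r a b) = r' a b) {l : List ι}
    (h : l.Pairwise (· < ·)) : star (listEta r l) = listEtaOp r' l := by
  induction l using List.reverseRecOn with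
  | nil => exact star_one M
  | append_singleton l z ih =>
    rw [listEta_append_singleton h, star_mul, ih (List.pairwise_append.1 h).1,
      listEtaOp_append_singleton hc h]
    congr 1
    clear h ih
    induction l with
    | nil => simp [leftProd, columnProd]
    | cons y l ih => rw [leftProd_cons, star_mul, ih, hr]; simp [columnProd]

/-- How the ordered product acts on an element attached to two neighbouring sites. -/
theorem semiconjBy_listEta (hc : DisjointCommute r) {a b : ι} {x x' : M}
    (hab : SemiconjBy (r a b) x x')
    (hx : ∀ y z, y ≠ z → a ≠ y → a ≠ z → b ≠ y → b ≠ z → Commute (r y z) x)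
    (hx' : ∀ y z, y ≠ z → a ≠ y → a ≠ z → b ≠ y → b ≠ z → Commute (r y z) x')
    (hleft : ∀ y, a ≠ y → b ≠ y → Commute (r y b * r y a) x)
    (hright : ∀ z, a ≠ z → b ≠ z → Commute (r b z * r a z) x')
    {l l' : List ι} (h : (l ++ a :: b :: l').Pairwise (· < ·)) :
    SemiconjBy (listEta r (l ++ a :: b :: l')) x x' := by
  induction l' using List.reverseRecOn with
  | nil =>
    have e : l ++ [a, b] = (l ++ [a]) ++ [b] := by simp
    rw [e] at h ⊢
    have hla := (List.pairwise_append.1 h).1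
    have hl := List.pairwise_append.1 hla
    have hlt : ∀ j ∈ l, j < a := fun j hj => hl.2.2 j hj a (List.mem_singleton_self a)
    have hltb : ∀ j ∈ l, j < b := fun j hj =>
      (List.pairwise_append.1 h).2.2 j (by simp [hj]) b (List.mem_singleton_self b)
    have halb : a < b := (List.pairwise_append.1 h).2.2 a (by simp) b (List.mem_singleton_self b)
    rw [listEta_append_singleton h, listEta_append_singleton hla, leftProd_append,
      ← mul_assoc, mul_assoc (leftProd r [a] b)]
    -- With `a, b` as the last sites, the product is `r a b`, times the paired columns of `b` and
    -- `a` over `l`, times the part inside `l`. The last two commute with `x`; only `r a b` turns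
    -- `x` into `x'`.
    refine SemiconjBy.mul_left (SemiconjBy.mul_left (y := x) ?_ ?_) (y := x) ?_
    · simpa [leftProd] using hab
    · exact commute_leftProd_mul_leftProd hc halb.ne (hl.1.imp fun h => h.ne)
        (fun h => (hlt a h).false) (fun h => (hltb b h).false)
        fun y hy => hleft y (hlt y hy).ne' (hltb y hy).ne'
    · exact (commute_listEta fun i hi j hj hij => (hx i j hij.ne (hlt i hi).ne' (hlt j hj).ne'
        (hltb i hi).ne' (hltb j hj).ne').symm).symm
  | append_singleton l' z ih =>
    have e : l ++ a :: b :: (l' ++ [z]) = (l ++ a :: b :: l') ++ [z] := by simp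
    rw [e] at h ⊢
    obtain ⟨h1, -, h2⟩ := List.pairwise_append.1 h
    have hz : ∀ j ∈ l ++ a :: b :: l', j < z := fun j hj => h2 j hj z (List.mem_singleton_self z)
    have hnd : (l ++ a :: b :: l').Nodup := h1.imp fun h => h.ne
    have haz : a ≠ z := (hz a (by simp)).ne
    have hbz : b ≠ z := (hz b (by simp)).ne
    have hal : ∀ j, j ∈ l ∨ j ∈ l' → a ≠ j ∧ b ≠ j := by
      intro j hj
      simp only [List.nodup_append, List.nodup_cons, List.mem_cons, not_or] at hnd
      refine ⟨?_, ?_⟩ <;> rintro rfl <;> rcases hj with hj | hj <;> grind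
    rw [listEta_append_singleton h]
    refine SemiconjBy.mul_left ?_ (ih h1)
    -- In the column of a later site `z` the factors `r b z * r a z` are adjacent, since `a` and `b`
    -- are neighbours; the others are disjoint from the bond.
    rw [leftProd_append, leftProd_cons, leftProd_cons, mul_assoc (leftProd r l' z)]
    have hcom : ∀ j, j ∈ l ∨ j ∈ l' → Commute x' (r j z) := fun j hj =>
      (hx' j z (hz j (by rcases hj with hj | hj <;> simp [hj])).ne (hal j hj).1 haz
        (hal j hj).2 hbz).symm
    exact ((commute_leftProd fun j hj => hcom j (Or.inr hj)).symm.mul_left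
      (hright z haz hbz)).mul_left (commute_leftProd fun j hj => hcom j (Or.inl hj)).symm

end OrderedProducts

/-! ### The metric operators -/

section Metric

variable {N d : ℕ}

theorem disjointCommute_embed (R : TwoSite d) :
    DisjointCommute fun a b : Fin N => embed R a b :=
  fun _ _ _ _ hab hce hac hae hbc hbe => embed_commute_embed R R hab hce hac hae hbc hbe

theorem eta_eq_listEta (R : TwoSite d) :
    eta N R = listEta (fun a b => embed R a b) (List.finRange N) := rfl

theorem IsRMatrix.eta_eq_etaOp {C R : TwoSite d} (h : IsRMatrix N C R) : eta N R = etaOp N R :=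
  listEta_eq_listEtaOp (disjointCommute_embed R) (fun _ _ _ => h.yangBaxter)
    (List.pairwise_lt_finRange N)

theorem conjTranspose_eta (R : TwoSite d) : (eta N R)ᴴ = etaOp N Rᴴ :=
  star_listEta (disjointCommute_embed Rᴴ) (fun a b => embed_conjTranspose R a b)
    (List.pairwise_lt_finRange N)

theorem bondL_ne_bondR (n : Fin (N - 1)) : (bondL n : Fin N) ≠ bondR n := by
  simp [bondL, bondR]

theorem exists_finRange_eq_append (n : Fin (N - 1)) :
    ∃ l l' : List (Fin N), List.finRange N = l ++ bondL n :: bondR n :: l' := by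
  have h1 : (n : ℕ) < (List.finRange N).length := by simp; omega
  have h2 : (n : ℕ) + 1 < (List.finRange N).length := by simp; omega
  refine ⟨(List.finRange N).take n, (List.finRange N).drop (n + 1 + 1), ?_⟩
  have e1 : bondL n = (List.finRange N)[(n : ℕ)] := by simp [bondL]
  have e2 : bondR n = (List.finRange N)[(n : ℕ) + 1] := by simp [bondR]
  rw [e1, e2, ← List.drop_eq_getElem_cons h2, ← List.drop_eq_getElem_cons h1, List.take_append_drop]

theorem IsRMatrix.semiconj_eta {C R : TwoSite d} (h : IsRMatrix N C R) (n : Fin (N - 1)) :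
    SemiconjBy (eta N R) (embed C (bondL n) (bondR n)) (embed C (bondR n) (bondL n)) := by
  obtain ⟨l, l', hl⟩ := exists_finRange_eq_append n
  have hn := bondL_ne_bondR n
  rw [eta_eq_listEta, hl]
  refine semiconjBy_listEta (disjointCommute_embed R) ?_ ?_ ?_ ?_ ?_
    (hl ▸ List.pairwise_lt_finRange N)
  · rw [← embed_swapConj C (bondL n)]
    exact embed_semiconj hn h.semiconj
  · exact fun y z hyz h1 h2 h3 h4 =>
      embed_commute_embed _ _ hyz hn h1.symm h3.symm h2.symm h4.symm
  · exact fun y z hyz h1 h2 h3 h4 =>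
      embed_commute_embed _ _ hyz hn.symm h3.symm h1.symm h4.symm h2.symm
  · exact fun y h1 h2 => h.commute_second hn h1 h2
  -- On the sites to the right the operator is already `C_{ba}`, so the roles of the two bond sites
  -- are exchanged.
  · exact fun z h1 h2 => h.commute_first hn.symm h2 h1

end Metric

/-! ### Lowest weight vectors and intertwiners -/

section ClebschGordan

variable {γ : ℝ} {d : ℕ}

/-- No q-number `[m]` with `1 ≤ m ≤ 2 d` vanishes. -/
def Generic (γ : ℝ) (d : ℕ) : Prop := ∀ m : ℕ, 1 ≤ m → m ≤ 2 * d → qNum γ m ≠ 0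

theorem ladder_self (γ : ℝ) (d : ℕ) : ladder γ d d = 0 := by simp [ladder]

theorem Generic.ladder_ne_zero (hg : Generic γ d) {s n : ℕ} (hs : s ≤ d) (hn : n < 2 * s) :
    ladder γ (2 * s) n ≠ 0 := by
  refine SpinChain.ladder_ne_zero ?_ ?_
  · rw [← Nat.cast_sub hn.le]
    exact hg _ (by omega) (by omega)
  · exact_mod_cast hg (n + 1) (by omega) (by omega)

/-- Extending the coefficients to all of `ℕ` avoids a boundary case: at `i = d` the out-of-range
value is multiplied by `ladder γ d d = 0`. -/
theorem sum_spinF_mul (g : ℕ → ℂ) (i : Fin (d + 1)) :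
    ∑ j : Fin (d + 1), spinF γ d i j * g j = ladder γ d i * g (i + 1) := by
  simp only [spinF_apply, ite_mul, zero_mul]
  by_cases hi : (i : ℕ) = d
  · rw [hi, ladder_self, zero_mul]
    exact Finset.sum_eq_zero fun j _ => if_neg (by omega)
  · have hlt : (i : ℕ) + 1 < d + 1 := by omega
    rw [Finset.sum_eq_single (⟨i + 1, hlt⟩ : Fin (d + 1))]
    · simp
    · intro j _ hj
      exact if_neg fun h => hj (Fin.ext h.symm)
    · simp

theorem coF_mulVec (g : ℕ → ℕ → ℂ) (x : Fin (d + 1) × Fin (d + 1)) :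
    (coF γ d *ᵥ fun y => g y.1 y.2) x =
      ladder γ d x.1 * qPow γ (-weight d x.2) * g (x.1 + 1) x.2 +
        qPow γ (weight d x.1) * ladder γ d x.2 * g x.1 (x.2 + 1) := by
  have h1 : ((spinF γ d ⊗ₖ spinKInv γ d) *ᵥ fun y => g y.1 y.2) x =
      ladder γ d x.1 * qPow γ (-weight d x.2) * g (x.1 + 1) x.2 := by
    rw [Matrix.mulVec, dotProduct, Fintype.sum_prod_type]
    simp only [Matrix.kroneckerMap_apply, spinKInv, Matrix.diagonal_apply, mul_ite, ite_mul, mul_zero,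
      zero_mul, Finset.sum_ite_eq, Finset.mem_univ, if_true]
    rw [mul_right_comm, ← sum_spinF_mul (fun i => g i x.2), Finset.sum_mul]
    exact Finset.sum_congr rfl fun i _ => mul_right_comm _ _ _
  have h2 : ((spinK γ d ⊗ₖ spinF γ d) *ᵥ fun y => g y.1 y.2) x =
      qPow γ (weight d x.1) * ladder γ d x.2 * g x.1 (x.2 + 1) := by
    rw [Matrix.mulVec, dotProduct, Fintype.sum_prod_type_right]
    simp only [Matrix.kroneckerMap_apply, spinK, Matrix.diagonal_apply, ite_mul,
      zero_mul, Finset.sum_ite_eq, Finset.mem_univ, if_true]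
    rw [mul_assoc, ← sum_spinF_mul (fun i => g x.1 i), Finset.mul_sum]
    exact Finset.sum_congr rfl fun i _ => mul_assoc _ _ _
  rw [coF, Matrix.add_mulVec, Pi.add_apply, h1, h2]

/-- The coefficients of the lowest weight vector of level `p`. -/
def lowestCoeff (γ : ℝ) (d p i : ℕ) : ℂ :=
  ∏ k ∈ Finset.range i, (-(qPow γ ((p : ℝ) - 1 - d) * ladder γ d (p - 1 - k)) / ladder γ d k)

/-- The lowest weight vector of level `p`, that is, of weight `p - d`. -/
def lowestVec (γ : ℝ) (d p : ℕ) : Fin (d + 1) × Fin (d + 1) → ℂ := fun x =>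
  if (x.1 : ℕ) + x.2 = p then lowestCoeff γ d p x.1 else 0

/-- The ratio of consecutive `lowestCoeff` is the two-term equation at level `p - 1` solved for the
next coefficient; `p ≤ d` keeps its denominators nonzero. -/
theorem coF_mulVec_lowestVec (hs : Small γ d) {p : ℕ} (hp : p ≤ d) :
    coF γ d *ᵥ lowestVec γ d p = 0 := by
  ext x
  refine (coF_mulVec (fun i j => if i + j = p then lowestCoeff γ d p i else 0) x).trans ?_
  simp only [Pi.zero_apply]
  by_cases hx : (x.1 : ℕ) + x.2 + 1 = p
  · rw [if_pos (by omega), if_pos (by omega), lowestCoeff, Finset.prod_range_succ, ← lowestCoeff,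
      show p - 1 - (x.1 : ℕ) = x.2 by omega]
    have h0 := hs.ladder_ne_zero (show (x.1 : ℕ) < d by omega)
    have hw : qPow γ (weight d x.1) =
        qPow γ (-weight d x.2) * qPow γ ((p : ℝ) - 1 - d) := by
      rw [← qPow_add, ← hx, weight, weight]
      push_cast
      congr 1
      ring
    rw [hw]
    field_simp
    ring
  · rw [if_neg (by omega), if_neg (by omega)]
    simp

theorem lowestVec_ne_zero {p : ℕ} (hp : p ≤ d) : lowestVec γ d p ≠ 0 := fun h => by
  have := congrFun h (0, ⟨p, by omega⟩)
  simp [lowestVec, lowestCoeff] at this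

/-- The vector `v` is supported on the basis vectors of total index `p`. -/
def HasLevel (v : Fin (d + 1) × Fin (d + 1) → ℂ) (p : ℕ) : Prop :=
  ∀ x, v x ≠ 0 → (x.1 : ℕ) + x.2 = p

theorem hasLevel_lowestVec (p : ℕ) : HasLevel (lowestVec γ d p) p := fun _ hx =>
  (ite_ne_right_iff.1 hx).1

theorem HasLevel.coE_mulVec {v : Fin (d + 1) × Fin (d + 1) → ℂ} {p : ℕ} (h : HasLevel v p) :
    HasLevel (coE γ d *ᵥ v) (p + 1) := by
  intro x hx
  obtain ⟨y, _, hy⟩ := Finset.exists_ne_zero_of_sum_ne_zero hx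
  rw [coE_apply_ne_zero (left_ne_zero_of_mul hy), h y (right_ne_zero_of_mul hy)]

/-- `F` is injective on the vectors of positive weight. -/
theorem HasLevel.eq_zero (hs : Small γ d) {v : Fin (d + 1) × Fin (d + 1) → ℂ} {p : ℕ}
    (h : HasLevel v p) (hp : d < p) (hv : coF γ d *ᵥ v = 0) : v = 0 := by
  set g : ℕ → ℕ → ℂ := fun i j =>
    if hij : i < d + 1 ∧ j < d + 1 then v (⟨i, hij.1⟩, ⟨j, hij.2⟩) else 0 with hg
  have hgv : (fun y : Fin (d + 1) × Fin (d + 1) => g y.1 y.2) = v := by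
    ext y
    exact dif_pos ⟨y.1.is_lt, y.2.is_lt⟩
  -- At `i = 0` the second index is `p > d`, out of range. The equation `F v = 0` at `(i, j)` then
  -- gives `g (i + 1) j = 0` from `g i (j + 1) = 0`.
  have key : ∀ i j, i + j = p → g i j = 0 := by
    intro i
    induction i with
    | zero => exact fun j hj => dif_neg (by omega)
    | succ i ih =>
      intro j hj
      by_cases hij : i + 1 < d + 1 ∧ j < d + 1
      · have h1 := coF_mulVec (γ := γ) g (⟨i, by omega⟩, ⟨j, hij.2⟩)
        rw [hgv, hv] at h1
        simp only [Pi.zero_apply] at h1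
        rw [ih (j + 1) (by omega), mul_zero, add_zero] at h1
        have h0 := hs.ladder_ne_zero (show i < d by omega)
        exact (mul_eq_zero.1 h1.symm).resolve_left (mul_ne_zero h0 (qPow_ne_zero _ _))
      · exact dif_neg hij
  ext x
  by_contra hx
  exact hx ((congrFun hgv x).symm.trans (key _ _ (h x hx)))

/-- The vectors generated by `E` from the lowest weight vector of weight `-s`. -/
def tower (γ : ℝ) (d s k : ℕ) : Fin (d + 1) × Fin (d + 1) → ℂ :=
  coE γ d ^ k *ᵥ lowestVec γ d (d - s)

theorem coE_mulVec_tower (s k : ℕ) : coE γ d *ᵥ tower γ d s k = tower γ d s (k + 1) := by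
  rw [tower, tower, Matrix.mulVec_mulVec, pow_succ']

theorem hasLevel_tower (s k : ℕ) : HasLevel (tower γ d s k) (d - s + k) := by
  induction k with
  | zero => simpa [tower] using hasLevel_lowestVec (d - s)
  | succ k ih =>
    rw [← coE_mulVec_tower]
    exact ih.coE_mulVec

/-- Induction with `F E = E F - [2H]`, starting from a vector that `F` kills; the coefficients add
up by `qNum_mul_qNum_sub`. -/
theorem coF_mulVec_tower_succ (hs : Small γ d) {s : ℕ} (hsd : s ≤ d) (k : ℕ) :
    coF γ d *ᵥ tower γ d s (k + 1) =
      ((qNum γ (((2 * s : ℕ) : ℝ) - k) * qNum γ ((k : ℝ) + 1) : ℝ) : ℂ) • tower γ d s k := by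
  have hdiag : ∀ k : ℕ, (Matrix.diagonal fun x => (qNum γ (2 * totalWeight d x) : ℂ)) *ᵥ
      tower γ d s k = (qNum γ (2 * ((k : ℝ) - s)) : ℂ) • tower γ d s k := by
    intro k
    ext x
    rw [Matrix.mulVec_diagonal, Pi.smul_apply, smul_eq_mul]
    by_cases h0 : tower γ d s k x = 0
    · rw [h0, mul_zero, mul_zero]
    · have := hasLevel_tower s k x h0
      rw [totalWeight_eq, this]
      push_cast [Nat.cast_sub hsd]
      congr 4
      ring
  have hstep : ∀ k : ℕ, coF γ d *ᵥ tower γ d s (k + 1) = coE γ d *ᵥ (coF γ d *ᵥ tower γ d s k) -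
      (qNum γ (2 * ((k : ℝ) - s)) : ℂ) • tower γ d s k := by
    intro k
    rw [← coE_mulVec_tower, Matrix.mulVec_mulVec, Matrix.mulVec_mulVec, ← hdiag,
      ← co_commutator hs.regular, ← Matrix.sub_mulVec]
    congr 1
    abel
  induction k with
  | zero =>
    have h0 : coF γ d *ᵥ tower γ d s 0 = 0 := by
      rw [tower, pow_zero, Matrix.one_mulVec, coF_mulVec_lowestVec hs (Nat.sub_le d s)]
    rw [hstep, h0, Matrix.mulVec_zero, zero_sub, ← neg_smul]
    congr 1
    push_cast
    rw [zero_add, qNum_one hs.regular, zero_sub, sub_zero, mul_neg, qNum_neg]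
    simp
  | succ k ih =>
    rw [hstep, ih, Matrix.mulVec_smul, coE_mulVec_tower, ← sub_smul, ← Complex.ofReal_sub]
    congr 2
    have h1 := qNum_mul_qNum_sub hs.regular (s : ℝ) ((s : ℝ) - k - 1)
    push_cast
    rw [show (s : ℝ) + (s - k - 1) = 2 * s - (k + 1) by ring,
      show (s : ℝ) - (s - k - 1) + 1 = k + 1 + 1 by ring,
      show (s : ℝ) - (s - k - 1) = k + 1 by ring,
      show 2 * (s : ℝ) - (k + 1) + 1 = 2 * s - k by ring,
      show 2 * ((s : ℝ) - k - 1) = -(2 * ((k : ℝ) + 1 - s)) by ring, qNum_neg] at h1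
    linear_combination -h1

/-- `F` kills this vector, because its coefficient contains `[2s - 2s]`; but its weight is `s + 1 >
0`, where `F` is injective. -/
theorem tower_eq_zero (hs : Small γ d) {s : ℕ} (hsd : s ≤ d) : tower γ d s (2 * s + 1) = 0 := by
  refine (hasLevel_tower s (2 * s + 1)).eq_zero hs (by omega) ?_
  rw [coF_mulVec_tower_succ hs hsd]
  simp

theorem tower_ne_zero (hs : Small γ d) (hg : Generic γ d) {s k : ℕ} (hsd : s ≤ d)
    (hk : k ≤ 2 * s) : tower γ d s k ≠ 0 := by
  induction k with
  | zero => simpa [tower] using lowestVec_ne_zero (Nat.sub_le d s)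
  | succ k ih =>
    intro h
    have h1 := coF_mulVec_tower_succ hs hsd k
    rw [h, Matrix.mulVec_zero, ← ladder_mul_self] at h1
    have h2 := hg.ladder_ne_zero hsd (show k < 2 * s by omega)
    exact ih (by omega) ((smul_eq_zero.1 h1.symm).resolve_left (mul_ne_zero h2 h2))

/-- The normalization of the vectors of the tower. -/
def towerNorm (γ : ℝ) (s k : ℕ) : ℂ := ∏ j ∈ Finset.range k, ladder γ (2 * s) j

theorem towerNorm_succ (γ : ℝ) (s k : ℕ) :
    towerNorm γ s (k + 1) = towerNorm γ s k * ladder γ (2 * s) k := Finset.prod_range_succ _ _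

theorem towerNorm_ne_zero (hg : Generic γ d) {s k : ℕ} (hsd : s ≤ d) (hk : k ≤ 2 * s) :
    towerNorm γ s k ≠ 0 :=
  Finset.prod_ne_zero_iff.2 fun j hj =>
    hg.ladder_ne_zero hsd (by have := Finset.mem_range.1 hj; omega)

/-- An embedding of the spin `s` module into the tensor square. -/
def towerMatrix (γ : ℝ) (d s : ℕ) : Matrix (Fin (d + 1) × Fin (d + 1)) (Fin (2 * s + 1)) ℂ :=
  fun x k => (towerNorm γ s k)⁻¹ * tower γ d s k x

theorem mul_towerMatrix_apply (A : TwoSite d) (s : ℕ) (x) (k : Fin (2 * s + 1)) :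
    (A * towerMatrix γ d s) x k = (towerNorm γ s k)⁻¹ * (A *ᵥ tower γ d s k) x := by
  rw [Matrix.mul_apply, Matrix.mulVec, dotProduct, Finset.mul_sum]
  exact Finset.sum_congr rfl fun y _ => mul_left_comm _ _ _

theorem isIntertwiner_towerMatrix (hs : Small γ d) (hg : Generic γ d) {s : ℕ} (hsd : s ≤ d) :
    IsIntertwiner γ d s (towerMatrix γ d s) := by
  refine ⟨?_, ?_, ?_⟩
  · ext x k
    rw [mul_towerMatrix_apply, coE_mulVec_tower, Matrix.mul_apply]
    -- A column of `E` is a row of its transpose `F`, so the same boundary-free sum applies.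
    have h := sum_spinF_mul (γ := γ) (d := 2 * s)
      (fun j => (towerNorm γ s j)⁻¹ * tower γ d s j x) k
    have e : ∀ j, towerMatrix γ d s x j * spinE γ (2 * s) j k =
        spinF γ (2 * s) k j * ((towerNorm γ s j)⁻¹ * tower γ d s j x) := fun j => by
      rw [← transpose_spinF, Matrix.transpose_apply, towerMatrix, mul_comm]
    rw [Finset.sum_congr rfl fun j _ => e j, h, towerNorm_succ]
    by_cases hk : (k : ℕ) = 2 * s
    · rw [hk, tower_eq_zero hs hsd]
      simp
    · have := hg.ladder_ne_zero hsd (show (k : ℕ) < 2 * s by omega)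
      rw [mul_inv_rev, mul_assoc, mul_inv_cancel_left₀ this]
  · ext x k
    rw [mul_towerMatrix_apply, Matrix.mul_apply]
    obtain ⟨k, hk⟩ := k
    simp only [spinF_apply]
    cases k with
    | zero =>
      have h0 : coF γ d *ᵥ tower γ d s 0 = 0 := by
        rw [tower, pow_zero, Matrix.one_mulVec, coF_mulVec_lowestVec hs (Nat.sub_le d s)]
      simp [h0]
    | succ k =>
      rw [Finset.sum_eq_single (⟨k, by omega⟩ : Fin (2 * s + 1)), if_pos rfl,
        coF_mulVec_tower_succ hs hsd, ← ladder_mul_self, towerNorm_succ, towerMatrix]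
      · have := hg.ladder_ne_zero hsd (show k < 2 * s by omega)
        simp only [Pi.smul_apply, smul_eq_mul]
        rw [mul_inv]
        field_simp
      · intro j _ hj
        rw [if_neg, mul_zero]
        intro h
        exact hj (Fin.ext (by simpa using h))
      · simp
  · rw [coK, spinK, Matrix.diagonal_kronecker_diagonal, spinK]
    ext x k
    rw [Matrix.diagonal_mul, Matrix.mul_diagonal, ← qPow_add, mul_comm]
    by_cases h0 : tower γ d s k x = 0
    · simp [towerMatrix, h0]
    · congr 2
      have h1 := totalWeight_eq x
      rw [hasLevel_tower s k x h0] at h1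
      change totalWeight d x = _
      rw [h1, weight]
      push_cast [Nat.cast_sub hsd]
      ring

/-- The columns are nonzero and live on different levels, hence have disjoint supports. -/
theorem injective_towerMatrix (hs : Small γ d) (hg : Generic γ d) {s : ℕ} (hsd : s ≤ d) :
    Function.Injective (towerMatrix γ d s).mulVecLin := by
  rw [injective_iff_map_eq_zero]
  intro c hc
  ext k
  obtain ⟨x, hx⟩ := Function.ne_iff.1 (tower_ne_zero hs hg hsd (Nat.lt_succ_iff.1 k.is_lt))
  have h := congrFun hc x
  rw [Matrix.mulVecLin_apply, Matrix.mulVec, dotProduct, Finset.sum_eq_single k] at h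
  · refine (mul_eq_zero.1 h).resolve_left (mul_ne_zero (inv_ne_zero ?_) hx)
    exact towerNorm_ne_zero hg hsd (Nat.lt_succ_iff.1 k.is_lt)
  · intro j _ hj
    have : tower γ d s j x = 0 := by
      by_contra h0
      have h1 := hasLevel_tower s j x h0
      have h2 := hasLevel_tower s k x hx
      exact hj (Fin.ext (by omega))
    rw [towerMatrix, this, mul_zero, zero_mul]
  · simp

theorem le_finrank_subV (hs : Small γ d) (hg : Generic γ d) {s : ℕ} (hsd : s ≤ d) :
    2 * s + 1 ≤ Module.finrank ℂ (subV γ d s) := by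
  have h1 := LinearMap.finrank_range_of_inj (injective_towerMatrix hs hg hsd)
  rw [Module.finrank_fin_fun] at h1
  rw [← h1]
  exact Submodule.finrank_mono
    (le_iSup₂_of_le (towerMatrix γ d s) (isIntertwiner_towerMatrix hs hg hsd) le_rfl)

/-! ### The Casimir operator on the irreducible components -/

theorem qNum_eq_zero_of_qPow_eq_one {x : ℝ} (h0 : γ ≠ 0) (h : qPow γ x = 1) : qNum γ x = 0 := by
  have := congrArg Complex.im h
  rw [qPow_eq_cos_add_sin] at this
  simp only [Complex.add_im, Complex.ofReal_im, Complex.mul_im, Complex.ofReal_re, Complex.I_im,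
    Complex.I_re, Complex.one_im] at this
  rw [qNum, if_neg h0, show Real.sin (γ * x) = 0 by linarith, zero_div]

/-- For `γ ≠ 0` the operator `K` fixes `q` to the weight; the two weights differ by an integer of
size at most `2d`, and `q^m = 1` would force `[m] = 0`. At `γ = 0` one has `K = 1`, and the weight
is read off from `[E, F] = 2H`. -/
theorem IsIntertwiner.weight_eq (hs : Small γ d) (hg : Generic γ d) {s : ℕ} (hsd : s ≤ d)
    {T : Matrix (Fin (d + 1) × Fin (d + 1)) (Fin (2 * s + 1)) ℂ} (hT : IsIntertwiner γ d s T)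
    {x k} (hx : T x k ≠ 0) : totalWeight d x = weight (2 * s) k := by
  obtain ⟨hE, hF, hK⟩ := hT
  by_cases h0 : γ = 0
  · have h1 : (coE γ d * coF γ d - coF γ d * coE γ d) * T =
        T * (spinE γ (2 * s) * spinF γ (2 * s) - spinF γ (2 * s) * spinE γ (2 * s)) := by
      rw [Matrix.sub_mul, Matrix.mul_sub, Matrix.mul_assoc, Matrix.mul_assoc, hE, hF,
        ← Matrix.mul_assoc, ← Matrix.mul_assoc, hE, hF, Matrix.mul_assoc, Matrix.mul_assoc]
    rw [co_commutator hs.regular, spin_commutator hs.regular] at h1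
    have h2 := congrFun (congrFun h1 x) k
    rw [Matrix.diagonal_mul, Matrix.mul_diagonal, mul_comm] at h2
    have h3 := mul_left_cancel₀ hx h2
    simp only [qNum, h0, if_true] at h3
    have h4 : 2 * totalWeight d x = 2 * weight (2 * s) k := by exact_mod_cast h3
    linarith
  · rw [coK, spinK, Matrix.diagonal_kronecker_diagonal, spinK] at hK
    have h2 := congrFun (congrFun hK x) k
    rw [Matrix.diagonal_mul, Matrix.mul_diagonal, mul_comm, ← qPow_add] at h2
    have h3 : qPow γ (totalWeight d x) = qPow γ (weight (2 * s) k) := mul_left_cancel₀ hx h2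
    have h4 : qNum γ (totalWeight d x - weight (2 * s) k) = 0 := by
      refine qNum_eq_zero_of_qPow_eq_one h0 ?_
      rw [sub_eq_add_neg, qPow_add, h3, qPow_mul_qPow_neg]
    have h5 : totalWeight d x - weight (2 * s) k =
        ((x.1 + x.2 + s : ℕ) : ℝ) - ((d + k : ℕ) : ℝ) := by
      rw [totalWeight_eq, weight]
      push_cast
      ring
    rw [h5] at h4
    rw [← sub_eq_zero, h5, sub_eq_zero]
    have hx1 := x.1.is_lt
    have hx2 := x.2.is_lt
    have hk := k.is_lt
    rcases lt_trichotomy ((x.1 : ℕ) + x.2 + s) (d + k) with h | h | h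
    · rw [← neg_sub, qNum_neg, neg_eq_zero, ← Nat.cast_sub h.le] at h4
      exact absurd h4 (hg _ (by omega) (by omega))
    · rw [h]
    · rw [← Nat.cast_sub h.le] at h4
      exact absurd h4 (hg _ (by omega) (by omega))

/-- The eigenvalue of the Casimir operator on the spin `s` module. -/
def casimirValue (γ : ℝ) (s : ℕ) : ℝ := qNum γ ((s : ℝ) + 1 / 2) ^ 2

theorem casimir_mul_of_isIntertwiner (hs : Small γ d) (hg : Generic γ d) {s : ℕ} (hsd : s ≤ d)
    {T : Matrix (Fin (d + 1) × Fin (d + 1)) (Fin (2 * s + 1)) ℂ} (hT : IsIntertwiner γ d s T) :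
    casimir γ d * T = (casimirValue γ s : ℂ) • T := by
  have hT' := hT
  obtain ⟨hE, hF, -⟩ := hT'
  have h1 : coF γ d * coE γ d * T = T * (spinF γ (2 * s) * spinE γ (2 * s)) := by
    rw [Matrix.mul_assoc, hE, ← Matrix.mul_assoc, hF, Matrix.mul_assoc]
  rw [casimir, Matrix.add_mul, h1, spinF_mul_spinE]
  ext x k
  rw [Matrix.add_apply, Matrix.mul_diagonal, casimirDiag, Matrix.diagonal_mul, Matrix.smul_apply,
    smul_eq_mul]
  by_cases h0 : T x k = 0
  · rw [h0]; simp
  · rw [hT.weight_eq hs hg hsd h0, mul_comm, ← add_mul, ← Complex.ofReal_add]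
    congr 2
    -- On weight `k`, `F E` is `[s - k][s + k + 1] = [s + 1/2]² - [k + 1/2]²`, so the dependence on
    -- `k` cancels.
    have h2 := qNum_sq_sub_sq γ ((s : ℝ) + 1 / 2) (weight (2 * s) k + 1 / 2)
    rw [casimirValue, ← eq_sub_iff_add_eq, h2, weight]
    push_cast
    rw [mul_comm]
    congr 2 <;> ring

theorem casimir_mulVec_of_mem_subV (hs : Small γ d) (hg : Generic γ d) {s : ℕ} (hsd : s ≤ d)
    {v} (hv : v ∈ subV γ d s) : casimir γ d *ᵥ v = (casimirValue γ s : ℂ) • v := by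
  suffices h : subV γ d s ≤
      Module.End.eigenspace (casimir γ d).mulVecLin (casimirValue γ s : ℂ) from
    Module.End.mem_eigenspace_iff.1 (h hv)
  refine iSup₂_le fun T hT => ?_
  rintro _ ⟨c, rfl⟩
  rw [Module.End.mem_eigenspace_iff, Matrix.mulVecLin_apply, Matrix.mulVecLin_apply,
    Matrix.mulVec_mulVec, casimir_mul_of_isIntertwiner hs hg hsd hT, Matrix.smul_mulVec]

/-- Two values differ by `[s + l + 1][s - l]`, and `s + l + 1 ≤ 2d` for `s ≠ l`; this is where the
whole range `m ≤ 4S` of the genericity condition is needed. -/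
theorem casimirValue_injective (hg : Generic γ d) :
    Function.Injective fun s : Fin (d + 1) => casimirValue γ s := by
  have key : ∀ s l : Fin (d + 1), (l : ℕ) < s → casimirValue γ s ≠ casimirValue γ l := by
    intro s l h
    have h1 := qNum_sq_sub_sq γ ((s : ℝ) + 1 / 2) ((l : ℝ) + 1 / 2)
    rw [← sub_ne_zero, casimirValue, casimirValue, h1,
      show (s : ℝ) + 1 / 2 + (l + 1 / 2) = ((s + l + 1 : ℕ) : ℝ) by push_cast; ring,
      show (s : ℝ) + 1 / 2 - (l + 1 / 2) = ((s - l : ℕ) : ℝ) by rw [Nat.cast_sub h.le]; ring]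
    exact mul_ne_zero (hg _ (by omega) (by omega)) (hg _ (by omega) (by omega))
  intro s l h
  rcases lt_trichotomy (s : ℕ) l with hlt | heq | hlt
  · exact absurd h.symm (key l s hlt)
  · exact Fin.ext heq
  · exact absurd h (key s l hlt)

theorem iSupIndep_subV (hs : Small γ d) (hg : Generic γ d) :
    iSupIndep fun s : Fin (d + 1) => subV γ d s := by
  have hinj : Function.Injective fun s : Fin (d + 1) => (casimirValue γ s : ℂ) :=
    Complex.ofReal_injective.comp (casimirValue_injective hg)
  refine ((Module.End.eigenspaces_iSupIndep (casimir γ d).mulVecLin).comp hinj).mono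
    fun s v hv => ?_
  exact Module.End.mem_eigenspace_iff.2
    (casimir_mulVec_of_mem_subV hs hg (Nat.lt_succ_iff.1 s.is_lt) hv)

/-- Independence bounds the sum of the dimensions by that of the whole space, so lower bounds that
add up to it must all be equalities. -/
theorem isInternal_of_le_finrank {K V ι : Type*} [Field K] [AddCommGroup V] [Module K V]
    [FiniteDimensional K V] [Fintype ι] [DecidableEq ι] {A : ι → Submodule K V} (hA : iSupIndep A)
    {n : ι → ℕ} (hn : ∀ i, n i ≤ Module.finrank K (A i)) (hsum : ∑ i, n i = Module.finrank K V) :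
    DirectSum.IsInternal A ∧ ∀ i, Module.finrank K (A i) = n i := by
  have hinj : Function.Injective (DirectSum.coeLinearMap A) := hA.dfinsupp_lsum_injective
  have h1 := LinearMap.finrank_le_finrank_of_injective hinj
  rw [Module.finrank_directSum] at h1
  have h2 := Finset.sum_le_sum fun i (_ : i ∈ Finset.univ) => hn i
  have h3 : ∑ i, n i = ∑ i, Module.finrank K (A i) := le_antisymm h2 (h1.trans hsum.ge)
  refine ⟨⟨hinj, (LinearMap.injective_iff_surjective_of_finrank_eq_finrank ?_).1 hinj⟩, fun i =>
    (((Finset.sum_eq_sum_iff_of_le fun i _ => hn i).1 h3) i (Finset.mem_univ i)).symm⟩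
  rw [Module.finrank_directSum, ← h3, hsum]

theorem isInternal_subV (hs : Small γ d) (hg : Generic γ d) :
    DirectSum.IsInternal (fun s : Fin (d + 1) => subV γ d s) ∧
      ∀ s : Fin (d + 1), Module.finrank ℂ (subV γ d s) = 2 * (s : ℕ) + 1 := by
  refine isInternal_of_le_finrank (iSupIndep_subV hs hg)
    (fun s => le_finrank_subV hs hg (Nat.lt_succ_iff.1 s.is_lt)) ?_
  rw [Module.finrank_fintype_fun_eq_card, Fintype.card_prod, Fintype.card_fin,
    Fin.sum_univ_eq_sum_range (fun s => 2 * s + 1)]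
  induction d + 1 with
  | zero => rfl
  | succ n ih => rw [Finset.sum_range_succ, ih]; ring

end ClebschGordan

/-! ### The projectors as polynomials in the Casimir operator -/

section Projectors

open Polynomial

variable {γ : ℝ} {d : ℕ}

theorem semiconjBy_aeval {A : Type*} [Ring A] [Algebra ℝ A] {a x y : A} (h : SemiconjBy a x y)
    (p : ℝ[X]) : SemiconjBy a (aeval x p) (aeval y p) := by
  induction p using Polynomial.induction_on' with
  | add p q hp hq => rw [map_add, map_add]; exact hp.add_right hq
  | monomial n c =>
    rw [aeval_monomial, aeval_monomial]
    exact SemiconjBy.mul_right (Algebra.commutes c a).symm (h.pow_right n)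

/-- Real coefficients are essential: they make the adjoint of a projector the same polynomial in the
adjoint Casimir operator. -/
theorem conjTranspose_aeval {m : Type*} [Fintype m] [DecidableEq m] (A : Matrix m m ℂ)
    (p : ℝ[X]) : (aeval A p)ᴴ = aeval Aᴴ p := by
  induction p using Polynomial.induction_on' with
  | add p q hp hq => rw [map_add, map_add, Matrix.conjTranspose_add, hp, hq]
  | monomial n c =>
    rw [aeval_monomial, aeval_monomial, ← Algebra.smul_def, ← Algebra.smul_def,
      Matrix.conjTranspose_smul, Matrix.conjTranspose_pow, star_trivial]

theorem aeval_mulVec {m : Type*} [Fintype m] [DecidableEq m] {A : Matrix m m ℂ} {v : m → ℂ}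
    {c : ℝ} (h : A *ᵥ v = (c : ℂ) • v) (p : ℝ[X]) :
    aeval A p *ᵥ v = ((p.eval c : ℝ) : ℂ) • v := by
  induction p using Polynomial.induction_on' with
  | add p q hp hq =>
    rw [map_add, Matrix.add_mulVec, hp, hq, eval_add, Complex.ofReal_add, add_smul]
  | monomial n r =>
    have hn : A ^ n *ᵥ v = ((c ^ n : ℝ) : ℂ) • v := by
      induction n with
      | zero => simp
      | succ n ih =>
        rw [pow_succ, ← Matrix.mulVec_mulVec, h, Matrix.mulVec_smul, ih, smul_smul]
        congr 1
        push_cast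
        ring
    rw [aeval_monomial, ← Algebra.smul_def, Matrix.smul_mulVec, hn, eval_monomial,
      Complex.ofReal_mul, mul_smul]
    rfl

/-- The Lagrange polynomial that is `1` at the Casimir value of spin `s` and `0` at the others. -/
def projPoly (γ : ℝ) (d : ℕ) (s : Fin (d + 1)) : ℝ[X] :=
  Lagrange.basis Finset.univ (fun l : Fin (d + 1) => casimirValue γ l) s

/-- The summands `V^l` span, and on each of them both sides act as the scalar `1` or `0`. -/
theorem proj_eq_aeval (hs : Small γ d) (hg : Generic γ d) (s : Fin (d + 1)) :
    proj γ d s = aeval (casimir γ d) (projPoly γ d s) := by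
  have hint := (isInternal_subV hs hg).1
  have htop := hint.submodule_iSup_eq_top
  have hc : IsCompl (subV γ d s) (⨆ l : {l : Fin (d + 1) // l ≠ s}, subV γ d (l : Fin (d + 1))) := by
    refine ⟨?_, ?_⟩
    · rw [iSup_subtype]
      exact hint.submodule_iSupIndep s
    · rw [codisjoint_iff, eq_top_iff, ← htop]
      refine iSup_le fun l => ?_
      by_cases h : l = s
      · exact h ▸ le_sup_left
      · exact le_sup_of_le_right
          (le_iSup (fun l : {l : Fin (d + 1) // l ≠ s} => subV γ d (l : Fin (d + 1))) ⟨l, h⟩)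
  rw [proj, dif_pos hc]
  apply Matrix.toLin'.injective
  rw [Matrix.toLin'_toMatrix', ← LinearMap.eqLocus_eq_top, eq_top_iff, ← htop]
  refine iSup_le fun l v hv => ?_
  rw [LinearMap.mem_eqLocus, Matrix.toLin'_apply,
    aeval_mulVec (casimir_mulVec_of_mem_subV hs hg (Nat.lt_succ_iff.1 l.is_lt) hv)]
  by_cases h : l = s
  · subst h
    rw [Submodule.projection_apply_of_mem_left hc hv, projPoly,
      Lagrange.eval_basis_self ((casimirValue_injective hg).injOn) (Finset.mem_univ l)]
    simp
  · have hq : v ∈ ⨆ l : {l : Fin (d + 1) // l ≠ s}, subV γ d (l : Fin (d + 1)) :=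
      le_iSup (fun l : {l : Fin (d + 1) // l ≠ s} => subV γ d (l : Fin (d + 1))) ⟨l, h⟩ hv
    rw [Submodule.projection_apply, (Submodule.projectionOnto_apply_eq_zero_iff hc).2 hq, projPoly,
      Lagrange.eval_basis_of_ne (v := fun l : Fin (d + 1) => casimirValue γ l) (Ne.symm h)
        (Finset.mem_univ l)]
    simp

theorem conjTranspose_proj (hs : Small γ d) (hg : Generic γ d) (s : Fin (d + 1)) :
    (proj γ d s)ᴴ = swapConj d (proj γ d s) := by
  rw [proj_eq_aeval hs hg, conjTranspose_aeval, conjTranspose_casimir hs]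
  exact aeval_algHom_apply ((swapConj d).restrictScalars ℝ) _ _

theorem embed_proj {N : ℕ} (hs : Small γ d) (hg : Generic γ d) (s : Fin (d + 1)) {a b : Fin N}
    (h : a ≠ b) : embed (proj γ d s) a b = aeval (embed (casimir γ d) a b) (projPoly γ d s) := by
  rw [proj_eq_aeval hs hg]
  exact (aeval_algHom_apply ((embedHom h).restrictScalars ℝ) _ _).symm

theorem conjTranspose_embed_proj {N : ℕ} (hs : Small γ d) (hg : Generic γ d) (s : Fin (d + 1))
    (a b : Fin N) : (embed (proj γ d s) a b)ᴴ = embed (proj γ d s) b a := by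
  rw [embed_conjTranspose, conjTranspose_proj hs hg, embed_swapConj]

theorem IsRMatrix.eta_mul_embed_proj {N : ℕ} (hs : Small γ d) (hg : Generic γ d) {R : TwoSite d}
    (hR : IsRMatrix N (casimir γ d) R) (n : Fin (N - 1)) (s : Fin (d + 1)) :
    eta N R * embed (proj γ d s) (bondL n) (bondR n) =
      embed (proj γ d s) (bondR n) (bondL n) * eta N R := by
  have hn := bondL_ne_bondR n
  rw [embed_proj hs hg s hn, embed_proj hs hg s hn.symm]
  exact semiconjBy_aeval (hR.semiconj_eta n) _

theorem IsRMatrix.eta_mul_hamiltonian {N : ℕ} (hs : Small γ d) (hg : Generic γ d) {R : TwoSite d}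
    (hR : IsRMatrix N (casimir γ d) R) (b : Fin (N - 1) → Fin (d + 1) → ℝ) :
    eta N R * hamiltonian γ N d b = (hamiltonian γ N d b)ᴴ * eta N R := by
  have h : (hamiltonian γ N d b)ᴴ =
      ∑ n, ∑ s, (b n s : ℂ) • embed (proj γ d s) (bondR n) (bondL n) := by
    simp only [hamiltonian, Matrix.conjTranspose_sum, Matrix.conjTranspose_smul,
      conjTranspose_embed_proj hs hg, Complex.star_def, Complex.conj_ofReal]
  rw [h]
  exact semiconjBy_sum _ fun n _ => semiconjBy_sum _ fun s _ =>
    semiconjBy_smul (hR.eta_mul_embed_proj hs hg n s) _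

end Projectors

end

end SpinChain

/-! ### Assembly of the three parts -/

theorem proposition2 (d : ℕ) (hd : 1 ≤ d) (γ : ℝ) (hγ : (d : ℝ) * |γ| < Real.pi) (N : ℕ) :
    -- the R-matrix is invertible
    IsUnit (SpinChain.RPlus γ d) ∧
    -- part a), for those γ at which no denominator [m] of the projectors vanishes; first the
    -- decomposition of the tensor square that defines the projectors
    ((∀ m : ℕ, 1 ≤ m → m ≤ 2 * d → SpinChain.qNum γ m ≠ 0) →
      (DirectSum.IsInternal (fun s : Fin (d + 1) => SpinChain.subV γ d s) ∧
        ∀ s : Fin (d + 1), Module.finrank ℂ (SpinChain.subV γ d s) = 2 * (s : ℕ) + 1) ∧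
      ∀ R ∈ ({SpinChain.RPlus γ d, SpinChain.RMinus γ d} : Set (SpinChain.TwoSite d)),
        (∀ (n : Fin (N - 1)) (s : Fin (d + 1)),
          SpinChain.eta N R *
              SpinChain.embed (SpinChain.proj γ d s) (SpinChain.bondL n) (SpinChain.bondR n) =
            (SpinChain.embed (SpinChain.proj γ d s)
              (SpinChain.bondL n) (SpinChain.bondR n)).conjTranspose * SpinChain.eta N R ∧
          (SpinChain.embed (SpinChain.proj γ d s)
              (SpinChain.bondL n) (SpinChain.bondR n)).conjTranspose * SpinChain.eta N R =
            SpinChain.embed (SpinChain.proj γ d s) (SpinChain.bondR n) (SpinChain.bondL n) *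
              SpinChain.eta N R) ∧
        ∀ b : Fin (N - 1) → Fin (d + 1) → ℝ,
          SpinChain.eta N R * SpinChain.hamiltonian γ N d b =
            (SpinChain.hamiltonian γ N d b).conjTranspose * SpinChain.eta N R) ∧
    -- part b)
    (SpinChain.eta N (SpinChain.RPlus γ d) = SpinChain.etaOp N (SpinChain.RPlus γ d) ∧
      SpinChain.eta N (SpinChain.RMinus γ d) = SpinChain.etaOp N (SpinChain.RMinus γ d)) ∧
    -- part c)
    (SpinChain.eta N (SpinChain.RPlus γ d)).conjTranspose =
      SpinChain.eta N (SpinChain.RMinus γ d) := by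
  have hs : SpinChain.Small γ d := ⟨hd, hγ⟩
  refine ⟨SpinChain.isUnit_RPlus hs, fun hg => ⟨SpinChain.isInternal_subV hs hg, fun R hR => ?_⟩,
    ⟨(SpinChain.isRMatrix_RPlus hs).eta_eq_etaOp, (SpinChain.isRMatrix_RMinus hs).eta_eq_etaOp⟩, ?_⟩
  · have hR : SpinChain.IsRMatrix N (SpinChain.casimir γ d) R := by
      rcases hR with rfl | rfl
      · exact SpinChain.isRMatrix_RPlus hs
      · exact SpinChain.isRMatrix_RMinus hs
    refine ⟨fun n s => ?_, hR.eta_mul_hamiltonian hs hg⟩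
    rw [SpinChain.conjTranspose_embed_proj hs hg]
    exact ⟨hR.eta_mul_embed_proj hs hg n s, rfl⟩
  -- The adjoint of `η⁺` is the opposite ordered product of `(R⁺)ᴴ = R⁻`, which part b) identifies
  -- with `η⁻`.
  · rw [(SpinChain.isRMatrix_RMinus hs).eta_eq_etaOp, SpinChain.conjTranspose_eta,
      SpinChain.RMinus_eq hs]
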